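/- **Model and algorithm.** For real $\alpha,\beta$ let $\Delta=\lfloor e^{\alpha/\beta}\rfloor$, and for $1\le i\le\Delta$ let $y_i=\lfloor e^\alpha/i^\beta\rfloor$, except that $y_1=\lfloor e^\alpha\rfloor+1$ if $\sum_{j=1}^{\Delta} j\lfloor e^\alpha/j^\beta\rfloor$ is odd. A random graph of the $(\alpha,\beta)$-model has $y_i$ vertices of degree $i$ for each $1\le i\le\Delta$. It is the multigraph (loops and parallel edges allowed) obtained by taking $\deg v$ copies of each vertex $v$, choosing a uniformly random perfect matching of all the copies, and joining $u$ and $v$ by one edge for each matched pair consisting of a copy of $u$ and a copy of $v$. The algorithm for Minimum Vertex Cover computes, for a multigraph $G=(V,E)$, an optimal solution $x:V\to\{0,\frac12,1\}$ of the linear program: minimize $\sum_v x(v)$ subject to $x\ge0$ and $x(u)+x(v)\ge1$ for every edge $uv$. It then rounds $x$ as follows. Let $L$ be the set of vertices $v$ with $\deg v=1$, or with $\deg v=2$ and $x(v)=\frac12$, and let $V'=L\cup N(L)$. Start with $y=x$ and all vertices unprocessed. In each step the items are visited in an arbitrary order, and all vertices of a treated item become processed. 1. For each vertex $v$ of degree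 1 with neighbour $u$: set $y(v)=0$, $y(u)=1$. 2. For each path $u v_1 v_2 w$ inside $G[V']$ with $\deg u\ge3$, $\deg v_1=\deg v_2=2$ and all four vertices still unprocessed: set $y(u)=y(w)=y(v_1)=1$, $y(v_2)=0$. 3. For each still unprocessed $v\in V'$ of degree 2 with $N(v)=\{u,w\}$ and $\deg u\ge3$: set $y(v)=0$, and set $y=1$ on those of $u,w$ that are unprocessed. 4. Do the same for each still unprocessed $v\in V'$ of degree 2 with $N(v)=\{u,w\}$, without the condition on $\deg u$. 5. Set $y(v)=1$ wherever still $y(v)=\frac12$. The output is $y$; write $y(V)=\sum_{v\in V}y(v)$, and let $\mathrm{OPT}(G)$ be the minimum size of a vertex cover of $G$. **Theorem.** The algorithm can be implemented in polynomial time, its output $y$ is always the indicator function of a vertex cover, and for every $\beta>2.424$ its expected approximation ratio on random graphs of the $(\alpha,\beta)$-model satisfies $$\limsup_{\alpha\to\infty}\ \mathbb E\left[\frac{y(V)}{\mathrm{OPT}(G)}\right]\ \le\ \rho'(\beta)=2-\frac{\zeta(\beta)-1-2^{-\beta}}{\zeta(\beta)}\left[1-\left(\frac{\zeta(\beta-1)-1-2^{1-\beta}}{\zeta(\beta-1)}\right)^{3}\right],$$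 whichever optimal half-integral solutions and visiting orders are used. Moreover this improves on the ratio of the first analysis: $$\rho'(\beta)<\rho(\beta)=2-\frac{\zeta(\beta)-1-2^{-\beta}}{2^{\beta}\zeta(\beta-1)\zeta(\beta)}\qquad\text{for all }\beta>2.424 .$$ -/

import Mathlib

open Finset Filter Topology
open scoped BigOperators

namespace PowerLawVC

/-! ### Multigraphs, vertex covers and the linear programming relaxation -/

/-- An undirected graph on `V` in which parallel edges and self-loops are allowed. -/
structure Multigraph (V : Type) where
  edges : Multiset (Sym2 V)

namespace Multigraph

variable {V : Type}

/-- `u` and `v` are joined by at least one edge. A vertex with a loop is adjacent to itself. -/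
def Adj (G : Multigraph V) (u v : V) : Prop := s(u, v) ∈ G.edges

/-- The degree of `v`: the number of edge ends at `v`, so that a loop counts twice. -/
def deg [DecidableEq V] (G : Multigraph V) (v : V) : ℕ :=
  (G.edges.map fun e => Multiset.count v e.toMultiset).sum

/-- Every edge has an endpoint in `C`. -/
def IsVertexCover (G : Multigraph V) (C : Finset V) : Prop :=
  ∀ e ∈ G.edges, ∃ v ∈ C, v ∈ e

/-- The minimum cardinality of a vertex cover. -/
noncomputable def opt (G : Multigraph V) : ℕ :=
  sInf {k | ∃ C : Finset V, G.IsVertexCover C ∧ C.card = k}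

/-- Feasible points of the linear programming relaxation of minimum vertex cover. -/
def LPFeasible (G : Multigraph V) (x : V → ℝ) : Prop :=
  (∀ v, 0 ≤ x v) ∧ ∀ u v, G.Adj u v → 1 ≤ x u + x v

/-- Half-integral points that are optimal for the linear program
`minimize ∑ v, x v` over all feasible real points `x`. -/
def IsOptimalHalfIntegral [Fintype V] (G : Multigraph V) (x : V → ℝ) : Prop :=
  (∀ v, x v = 0 ∨ x v = 1 / 2 ∨ x v = 1) ∧ G.LPFeasible x ∧
    ∀ z, G.LPFeasible z → ∑ v, x v ≤ ∑ v, z v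

end Multigraph

/-! ### The deterministic rounding procedure -/

section Rounding

variable {V : Type} [DecidableEq V]

/-- The working state of the rounding procedure: the current assignment and the set of vertices
that are marked as processed. -/
structure RoundState (V : Type) where
  y : V → ℝ
  processed : Finset V

/-- `s'` results from `s` by the loop "for all `i ∈ cands` do `body i`", the candidates being
visited once each, in some order. -/
def ForAll {ι S : Type} (cands : Set ι) (body : S → ι → S) (s s' : S) : Prop :=
  ∃ l : List ι, l.Nodup ∧ (∀ i, i ∈ l ↔ i ∈ cands) ∧ s' = l.foldl body s

/-- `L`: the vertices of degree 1, and the vertices of degree 2 with value 1/2. -/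
def lowSet (G : Multigraph V) (x : V → ℝ) : Set V :=
  {v | (G.deg v = 2 ∧ x v = 1 / 2) ∨ G.deg v = 1}

/-- `V' = L ∪ N(L)`. -/
def lowClosure (G : Multigraph V) (x : V → ℝ) : Set V :=
  {v | v ∈ lowSet G x ∨ ∃ u ∈ lowSet G x, G.Adj u v}

/-- Step 1 visits the pairs `(v, u)` where `v` has degree 1 and `u` is its neighbour. -/
def cands1 (G : Multigraph V) : Set (V × V) :=
  {p | G.deg p.1 = 1 ∧ G.Adj p.1 p.2}

def body1 (s : RoundState V) : V × V → RoundState V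
  | (v, u) =>
    { y := Function.update (Function.update s.y v 0) u 1
      processed := s.processed ∪ {v, u} }

/-- Step 2 visits the paths `u v₁ v₂ w` in the subgraph induced by `V'` with `deg u ≥ 3` and
`deg v₁ = deg v₂ = 2`. -/
def cands2 (G : Multigraph V) (x : V → ℝ) : Set (V × V × V × V) :=
  {p | match p with
    | (u, v₁, v₂, w) =>
      [u, v₁, v₂, w].Nodup ∧ (∀ a ∈ [u, v₁, v₂, w], a ∈ lowClosure G x) ∧
        G.Adj u v₁ ∧ G.Adj v₁ v₂ ∧ G.Adj v₂ w ∧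
        3 ≤ G.deg u ∧ G.deg v₁ = 2 ∧ G.deg v₂ = 2}

def body2 (s : RoundState V) : V × V × V × V → RoundState V
  | (u, v₁, v₂, w) =>
    if u ∉ s.processed ∧ v₁ ∉ s.processed ∧ v₂ ∉ s.processed ∧ w ∉ s.processed then
      { y := Function.update (Function.update (Function.update (Function.update s.y
          u 1) w 1) v₁ 1) v₂ 0
        processed := s.processed ∪ {u, v₁, v₂, w} }
    else s

/-- Step 4 visits the vertices `v ∈ V'` of degree 2, with neighbourhood `N(v) = {u, w}`. Here
`u = w` if `v` has two parallel edges, and `u = w = v` if `v` carries a loop. A triple is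
`(u, v, w)`. -/
def cands4 (G : Multigraph V) (x : V → ℝ) : Set (V × V × V) :=
  {p | match p with
    | (u, v, w) => v ∈ lowClosure G x ∧ G.deg v = 2 ∧ ∀ t, G.Adj v t ↔ t = u ∨ t = w}

/-- Step 3 visits those triples of step 4 for which moreover `deg u ≥ 3`. -/
def cands3 (G : Multigraph V) (x : V → ℝ) : Set (V × V × V) :=
  {p | p ∈ cands4 G x ∧ 3 ≤ G.deg p.1}

/-- The body of steps 3 and 4 at the vertex `v` with neighbours `u` and `w`. -/
def body34 (s : RoundState V) : V × V × V → RoundState V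
  | (u, v, w) =>
    if v ∈ s.processed then s
    else
      { y :=
          if u ∉ s.processed ∧ w ∈ s.processed then
            Function.update (Function.update s.y v 0) u 1
          else if u ∉ s.processed ∧ w ∉ s.processed then
            Function.update (Function.update (Function.update s.y v 0) u 1) w 1
          else if u ∈ s.processed ∧ w ∈ s.processed then
            Function.update s.y v 0
          else
            Function.update (Function.update s.y v 0) w 1
        processed := s.processed ∪ {u, v, w} }

open Classical in
/-- Step 5 rounds up the values that are still equal to 1/2. -/
noncomputable def step5 (y : V → ℝ) : V → ℝ := fun v => if y v = 1 / 2 then 1 else y v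

/-- `y` is the result of a run of the deterministic rounding procedure on `(G, x)`. -/
def IsRounding (G : Multigraph V) (x y : V → ℝ) : Prop :=
  ∃ s₁ s₂ s₃ s₄ : RoundState V,
    ForAll (cands1 G) body1 ⟨x, ∅⟩ s₁ ∧
    ForAll (cands2 G x) body2 s₁ s₂ ∧
    ForAll (cands3 G x) body34 s₂ s₃ ∧
    ForAll (cands4 G x) body34 s₃ s₄ ∧
    y = step5 s₄.y

/-- `y` is a possible output of the whole approximation algorithm on `G`: compute an optimal
half-integral solution of the linear program and round it. -/
def IsAlgorithmOutput [Fintype V] (G : Multigraph V) (y : V → ℝ) : Prop :=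
  ∃ x, G.IsOptimalHalfIntegral x ∧ IsRounding G x y

end Rounding

/-! ### A random access machine with a step count

The memory consists of arrays of natural numbers, `m a i` being entry `i` of array `a`. Programs
are built from assignments, branching and loops whose number of rounds is evaluated on entry.
The arithmetic operations are addition and truncated subtraction; every operation costs one
step. -/

abbrev Memory := ℕ → ℕ → ℕ

inductive Expr where
  | const (c : ℕ)
  | cell (a : ℕ) (i : Expr)
  | add (e f : Expr)
  | sub (e f : Expr)

namespace Expr

def eval (m : Memory) : Expr → ℕ
  | const c => c
  | cell a i => m a (i.eval m)
  | add e f => e.eval m + f.eval m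
  | sub e f => e.eval m - f.eval m

/-- The number of operations in the evaluation of an expression. -/
def cost : Expr → ℕ
  | const _ => 1
  | cell _ i => i.cost + 1
  | add e f => e.cost + f.cost + 1
  | sub e f => e.cost + f.cost + 1

end Expr

inductive Program where
  | skip
  /-- Array `a`, entry `i`, receives the value of `e`. -/
  | assign (a : ℕ) (i e : Expr)
  | seq (p q : Program)
  /-- If the value of `e` is nonzero then `p`, else `q`. -/
  | branch (e : Expr) (p q : Program)
  /-- Repeat `p` as many times as the value that `e` has on entry. -/
  | loop (e : Expr) (p : Program)

namespace Program

/-- The memory after the execution of a program. -/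
def exec : Program → Memory → Memory
  | skip, m => m
  | assign a i e, m => Function.update m a (Function.update (m a) (i.eval m) (e.eval m))
  | seq p q, m => q.exec (p.exec m)
  | branch e p q, m => if e.eval m ≠ 0 then p.exec m else q.exec m
  | loop e p, m => p.exec^[e.eval m] m

/-- The number of steps in the execution of a program. -/
def steps : Program → Memory → ℕ
  | skip, _ => 1
  | assign _ i e, _ => i.cost + e.cost + 1
  | seq p q, m => p.steps m + q.steps (p.exec m)
  | branch e p q, m => e.cost + 1 + if e.eval m ≠ 0 then p.steps m else q.steps m
  | loop e p, m => e.cost + 1 + ∑ j ∈ Finset.range (e.eval m), (p.steps (p.exec^[j] m) + 1)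

end Program

/-- The multigraph with a given list of edges. -/
def graphOfList {n : ℕ} (es : List (Fin n × Fin n)) : Multigraph (Fin n) :=
  ⟨(es.map fun p => s(p.1, p.2) : List (Sym2 (Fin n)))⟩

/-- The initial memory for a graph on `n` vertices with edge list `es`: entry 0 of arrays 0 and 1
holds the number of vertices and the number of edges, arrays 2 and 3 hold the first and the
second endpoints of the edges. Everything else is 0. -/
def inputMemory {n : ℕ} (es : List (Fin n × Fin n)) : Memory := fun a i =>
  match a with
  | 0 => if i = 0 then n else 0
  | 1 => if i = 0 then es.length else 0
  | 2 => (es[i]?.map fun p => (p.1 : ℕ)).getD 0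
  | 3 => (es[i]?.map fun p => (p.2 : ℕ)).getD 0
  | _ => 0

/-- The output of a program is read off array 4. -/
def output (P : Program) {n : ℕ} (es : List (Fin n × Fin n)) : Fin n → ℝ :=
  fun v => (P.exec (inputMemory es) 4 v : ℝ)

/-! ### Random power law graphs -/

/-- The maximum degree `Δ = ⌊e^(α/β)⌋`. -/
noncomputable def maxDeg (α β : ℝ) : ℕ := ⌊Real.exp (α / β)⌋₊

/-- `⌊e^α / i^β⌋`. -/
noncomputable def rawCount (α β : ℝ) (i : ℕ) : ℕ := ⌊Real.exp α / (i : ℝ) ^ β⌋₊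

/-- The number of vertices of degree `i`, for `1 ≤ i ≤ Δ`: it is `⌊e^α / i^β⌋`, except that one
vertex of degree 1 is added if otherwise the sum of the degrees were odd. -/
noncomputable def degCount (α β : ℝ) (i : ℕ) : ℕ :=
  if 1 < i ∨ Even (∑ j ∈ Finset.Icc 1 (maxDeg α β), j * rawCount α β j) then rawCount α β i
  else rawCount α β 1 + 1

/-- The number of vertices. -/
noncomputable def numVertices (α β : ℝ) : ℕ := ∑ i : Fin (maxDeg α β), degCount α β (i + 1)

/-- The prescribed degrees: the vertices are listed by increasing degree, `degCount α β i`
of them having degree `i`. -/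
noncomputable def prescribedDeg (α β : ℝ) (v : Fin (numVertices α β)) : ℕ :=
  (finSigmaFinEquiv.symm v).1 + 1

/-- The set of copies: `deg v` distinct copies of each vertex `v`. -/
abbrev Copies (α β : ℝ) : Type := Σ v : Fin (numVertices α β), Fin (prescribedDeg α β v)

/-- The perfect matchings of a set `H`, as involutions without fixed points. -/
abbrev PerfectMatching (H : Type) : Type := {σ : Equiv.Perm H // ∀ h, σ (σ h) = h ∧ σ h ≠ h}

/-- The multigraph given by a perfect matching of the copies: one edge joining `u` and `v` for
every matched pair that consists of a copy of `u` and a copy of `v`. -/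
def matchingGraph {n : ℕ} {d : Fin n → ℕ} (σ : PerfectMatching (Σ v : Fin n, Fin (d v))) :
    Multigraph (Fin n) :=
  ⟨(Finset.univ.image fun h => s(h, σ.1 h)).val.map (Sym2.map Sigma.fst)⟩

/-- The expectation of `f` under the `(α, β)`-model, whose randomness is a perfect matching of
the copies that is chosen uniformly. -/
noncomputable def modelExpectation (α β : ℝ) (f : PerfectMatching (Copies α β) → ℝ) : ℝ :=
  𝔼 σ, f σ

theorem sum_prescribedDeg (α β : ℝ) : Even (∑ v, prescribedDeg α β v) := by
  have h1 : ∑ v, prescribedDeg α β v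
      = ∑ i : Fin (maxDeg α β), degCount α β (i + 1) * ((i : ℕ) + 1) := by
    unfold prescribedDeg numVertices
    rw [← Equiv.sum_comp finSigmaFinEquiv]
    simp only [Equiv.symm_apply_apply]
    rw [Fintype.sum_sigma]
    simp
  rw [h1, Fin.sum_univ_eq_sum_range (fun i => degCount α β (i + 1) * (i + 1))]
  have h2 : ∑ j ∈ Finset.Icc 1 (maxDeg α β), j * rawCount α β j
      = ∑ i ∈ Finset.range (maxDeg α β), (i + 1) * rawCount α β (i + 1) := by
    rw [Finset.range_eq_Ico, Finset.sum_Ico_add' (fun j => j * rawCount α β j) 0 _ 1]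
    rfl
  by_cases hE : Even (∑ j ∈ Finset.Icc 1 (maxDeg α β), j * rawCount α β j)
  · have : ∀ i, degCount α β i = rawCount α β i := fun i => by simp [degCount, hE]
    simp only [this]
    rw [h2] at hE
    simpa only [mul_comm] using hE
  · have h0 : maxDeg α β ≠ 0 := by
      intro h0
      apply hE
      simp [h0]
    obtain ⟨k, hk⟩ := Nat.exists_eq_succ_of_ne_zero h0
    have hO := hE
    rw [h2, hk, Finset.sum_range_succ'] at hO
    rw [hk, Finset.sum_range_succ']
    have ha : ∀ i, degCount α β (i + 1 + 1) = rawCount α β (i + 1 + 1) := fun i => by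
      simp [degCount]
    have hb : degCount α β (0 + 1) = rawCount α β 1 + 1 := by
      unfold degCount
      rw [if_neg]
      rintro (h | h)
      · omega
      · exact hE h
    simp only [ha, hb]
    simp only [mul_comm _ (_ + 1 + 1)]
    simp only [zero_add, one_mul, mul_one, Nat.not_even_iff_odd] at hO ⊢
    rw [← add_assoc]
    exact hO.add_one

/-- The copies can be perfectly matched, so the model is well defined. -/
instance perfectMatching_nonempty (α β : ℝ) : Nonempty (PerfectMatching (Copies α β)) := by
  obtain ⟨k, hk⟩ := sum_prescribedDeg α β
  have hc : Fintype.card (Copies α β) = Fintype.card (Fin k × Bool) := by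
    simp [Copies, hk]
    omega
  let e := Fintype.equivOfCardEq hc
  let t : Equiv.Perm (Fin k × Bool) := (Equiv.refl _).prodCongr Equiv.boolNot
  refine ⟨⟨(e.trans t).trans e.symm, fun h => ⟨?_, fun h' => ?_⟩⟩⟩
  · have h1 : ∀ z, t (t z) = z := fun z => by rcases z with ⟨a, _ | _⟩ <;> rfl
    simp [h1]
  · have h2 := congrArg (fun z => (e z).2) h'
    simp [t] at h2

/-! ### The approximation ratios -/

/-- The Riemann zeta function at a real argument. -/
noncomputable def realZeta (s : ℝ) : ℝ := (riemannZeta (s : ℂ)).re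

/-- The ratio of the refined analysis. -/
noncomputable def refinedRatio (β : ℝ) : ℝ :=
  2 - (realZeta β - 1 - (2 : ℝ) ^ (-β)) / realZeta β *
    (1 - ((realZeta (β - 1) - 1 - (2 : ℝ) ^ (1 - β)) / realZeta (β - 1)) ^ 3)

/-- The ratio of the first analysis. -/
noncomputable def firstRatio (β : ℝ) : ℝ :=
  2 - (realZeta β - 1 - (2 : ℝ) ^ (-β)) / ((2 : ℝ) ^ β * realZeta (β - 1) * realZeta β)

end PowerLawVC

open PowerLawVC

/-! The ratio bound is deterministic: once `α ≥ 0` and `e^α ≥ 1000`, it holds for every matching of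
the copies, and only the degree sequence matters.

Let `H` be the set of vertices set to 1 in step 1, of which `a` have degree 1 and `b` do not. Each
of them has a private neighbour of degree 1 with value 0, so the LP solution `x` has mass at least
`a + b` on the vertices treated in step 1, and there `2x - y` sums to at least `a + b`. Every later
step adds a nonnegative amount to `∑ (2x - y)`. As the LP value is at most OPT, `y(V) + a + b ≤ 2
OPT`. Two more counts complete `IsAlgorithmOutput.bounds`: `y(V)` is at most `a` plus the number of
vertices of degree other than 1, and every vertex of degree 1 lies in `H` or is adjacent to `H`, so
the degrees of `H` bound their number.

With `N = e^α`, `Z = ζ(β)`, `A = Z - 1 - 2^(-β)`, there are at least `N - 1` vertices of degree 1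
and at most `N (Z - 1)` others. Cutting degrees at 8 makes `a + b` at least about `N (1 - T) / 8`,
where `T` bounds the excess of the degrees over 8. The inequality `realZeta_bound` then yields the
ratio `2 - A / Z`, which is at most `ρ'(β)` because the bracket in `ρ'` is at most 1
(`ratio_le_refinedRatio`).

The output is a cover because a processed vertex of value 0 always has all its neighbours processed
with value 1 (`RoundState.Valid`).

For polynomial time an explicit program is verified. An auction computes a maximum matching of the
bipartite double cover. A number not used as a price splits the vertices into a cover of the double
cover of equal size, and averaging its two sides gives an optimal half-integral `x`
(`PriceInvariant.isOptimalHalfIntegral`). The rounding steps are loops over all tuples of vertices.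
All loop bounds are input sizes, so the step count is polynomial (`LoopBounded.exists_polynomial`).
-/

namespace PowerLawVC

/-! ### Degrees, neighbours and the LP lower bound on OPT -/

namespace Multigraph

variable {V : Type} {G : Multigraph V}

theorem Adj.symm {u v : V} (h : G.Adj u v) : G.Adj v u := by
  unfold Adj at *
  rwa [Sym2.eq_swap]

variable [DecidableEq V]

/-- Distinct neighbours use up distinct edge ends, and a loop uses up two of them. -/
theorem sum_neighbors_le_deg (v : V) (T : Finset V) (hT : ∀ t ∈ T, G.Adj v t) :
    ∑ t ∈ T, (if t = v then 2 else 1) ≤ G.deg v := by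
  have hinj : Function.Injective fun t : V => s(v, t) := fun a b h => Sym2.congr_right.1 h
  have hsub : (T.map ⟨_, hinj⟩).val ≤ G.edges := by
    rw [Multiset.le_iff_subset (Finset.nodup _)]
    intro e he
    simp only [Finset.mem_val, Finset.mem_map, Function.Embedding.coeFn_mk] at he
    obtain ⟨t, ht, rfl⟩ := he
    exact hT t ht
  obtain ⟨R, hR⟩ := Multiset.le_iff_exists_add.1 hsub
  unfold deg
  rw [hR, Multiset.map_add, Multiset.sum_add]
  refine le_trans ?_ (Nat.le_add_right _ _)
  rw [Finset.map_val, Multiset.map_map, ← Finset.sum_eq_multiset_sum]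
  refine Finset.sum_le_sum fun t _ => ?_
  by_cases h : t = v
  · subst h; simp [Sym2.toMultiset]
  · have : s(v, t).toMultiset = {v, t} := rfl
    simp [this, h]

theorem card_neighbors_le_deg (v : V) (T : Finset V) (hT : ∀ t ∈ T, G.Adj v t) :
    T.card ≤ G.deg v := by
  refine le_trans ?_ (sum_neighbors_le_deg v T hT)
  rw [Finset.card_eq_sum_ones]
  exact Finset.sum_le_sum fun t _ => by split_ifs <;> norm_num

theorem eq_of_deg_eq_one {u v t : V} (hv : G.deg v = 1) (hu : G.Adj v u) (ht : G.Adj v t) :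
    t = u := by
  by_contra h
  have := G.card_neighbors_le_deg v {t, u} (by simp [hu, ht])
  rw [Finset.card_pair h] at this
  omega

theorem ne_of_deg_eq_one {u v : V} (hv : G.deg v = 1) (hu : G.Adj v u) : u ≠ v := by
  rintro rfl
  have := G.sum_neighbors_le_deg u {u} (by simp [hu])
  simp at this
  omega

theorem eq_or_eq_of_deg_eq_two {u w v t : V} (hv : G.deg v = 2) (hu : G.Adj v u) (hw : G.Adj v w)
    (huw : u ≠ w) (ht : G.Adj v t) : t = u ∨ t = w := by
  by_contra! h
  have := G.card_neighbors_le_deg v {t, u, w} (by simp [hu, hw, ht])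
  rw [Finset.card_eq_three.2 ⟨t, u, w, h.1, h.2, huw, rfl⟩] at this
  omega

theorem eq_of_deg_eq_two_of_loop {v t : V} (hv : G.deg v = 2) (h : G.Adj v v) (ht : G.Adj v t) :
    t = v := by
  by_contra hne
  have := G.sum_neighbors_le_deg v {t, v} (by simp [h, ht])
  rw [Finset.sum_pair hne] at this
  simp [hne] at this
  omega

theorem exists_adj_of_deg_ne_zero {v : V} (hv : G.deg v ≠ 0) : ∃ u, G.Adj v u := by
  by_contra! h
  apply hv
  unfold deg
  rw [Multiset.sum_eq_zero_iff]
  simp only [Multiset.mem_map, forall_exists_index, and_imp, forall_apply_eq_imp_iff₂]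
  intro e he
  rw [Multiset.count_eq_zero, Sym2.mem_toMultiset]
  intro hve
  obtain ⟨u, rfl⟩ := hve
  exact h u he

variable [Fintype V]

omit [DecidableEq V] in
theorem exists_cover_card_eq_opt (G : Multigraph V) :
    ∃ C : Finset V, G.IsVertexCover C ∧ C.card = G.opt := by
  refine Nat.sInf_mem (s := {k | ∃ C : Finset V, G.IsVertexCover C ∧ C.card = k})
    ⟨_, Finset.univ, fun e _ => ?_, rfl⟩
  induction e with
  | h a b => exact ⟨a, Finset.mem_univ _, by simp⟩

/-- The value of the linear program is at most the size of a vertex cover. -/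
theorem IsOptimalHalfIntegral.sum_le_opt {x : V → ℝ} (hx : G.IsOptimalHalfIntegral x) :
    ∑ v, x v ≤ G.opt := by
  obtain ⟨C, hC, hcard⟩ := G.exists_cover_card_eq_opt
  have := hx.2.2 (fun v => if v ∈ C then 1 else 0) ⟨fun v => by dsimp only; split_ifs <;> norm_num,
    fun u v huv => by
      obtain ⟨t, ht, hte⟩ := hC _ huv
      rcases Sym2.mem_iff.1 hte with rfl | rfl <;> simp only [ht, if_true] <;> split_ifs <;>
        norm_num⟩
  simpa [hcard] using this

end Multigraph

/-! ### Invariants of the rounding procedure and the deterministic bounds -/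

section Rounding

variable {V : Type} [DecidableEq V] {G : Multigraph V} {x : V → ℝ}

theorem ForAll.induct {ι S : Type} {cands : Set ι} {body : S → ι → S} {s s' : S}
    (h : ForAll cands body s s') (M : S → Prop) (h0 : M s)
    (hstep : ∀ t, ∀ i ∈ cands, M t → M (body t i)) : M s' := by
  obtain ⟨l, -, hl, rfl⟩ := h
  have : ∀ i ∈ l, i ∈ cands := fun i hi => (hl i).1 hi
  clear hl
  induction l generalizing s with
  | nil => exact h0
  | cons a l ih =>
    exact ih (hstep _ _ (this a (by simp)) h0) fun i hi => this i (by simp [hi])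

/-- The invariant of the rounding procedure. -/
structure RoundState.Valid (G : Multigraph V) (x : V → ℝ) (s : RoundState V) : Prop where
  unprocessed : ∀ v ∉ s.processed, s.y v = x v
  binary : ∀ v ∈ s.processed, s.y v = 0 ∨ s.y v = 1
  zero : ∀ v ∈ s.processed, s.y v = 0 → ∀ t, G.Adj v t → t ∈ s.processed ∧ s.y t = 1

-- This is why steps 3 and 4 may set a vertex to 0 without touching its processed neighbours.
omit [DecidableEq V] in
theorem RoundState.Valid.eq_one_of_adj {s : RoundState V} (hs : s.Valid G x) {u v : V}
    (hv : v ∉ s.processed) (hu : u ∈ s.processed) (h : G.Adj v u) : s.y u = 1 :=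
  (hs.binary u hu).resolve_left fun h0 => hv (hs.zero u hu h0 v h.symm).1

/-- The four branches merge into one formula. Testing for a neighbour before testing for `v` gives
the value 1 to a vertex with a loop, where `u = v = w`. -/
theorem body34_y {s : RoundState V} {u v w : V} (hv : v ∉ s.processed) (t : V) :
    (body34 s (u, v, w)).y t
      = if (t = u ∨ t = w) ∧ t ∉ s.processed then 1 else if t = v then 0 else s.y t := by
  simp only [body34, hv, if_false]
  by_cases hu : u ∈ s.processed <;> by_cases hw : w ∈ s.processed <;>
    simp only [hu, hw, not_true, not_false_iff, and_true, and_false, if_true, if_false,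
      Function.update_apply] <;> grind

theorem body34_processed {s : RoundState V} {u v w : V} (hv : v ∉ s.processed) :
    (body34 s (u, v, w)).processed = s.processed ∪ {u, v, w} := by
  simp [body34, hv]

theorem body2_y {s : RoundState V} {u v₁ v₂ w : V} (hu : u ∉ s.processed) (h₁ : v₁ ∉ s.processed)
    (h₂ : v₂ ∉ s.processed) (hw : w ∉ s.processed) (t : V) :
    (body2 s (u, v₁, v₂, w)).y t
      = if t = v₂ then 0 else if t = u ∨ t = v₁ ∨ t = w then 1 else s.y t := by
  simp only [body2, hu, h₁, h₂, hw, not_false_iff, and_self, if_true, Function.update_apply]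
  grind

theorem body2_processed {s : RoundState V} {u v₁ v₂ w : V} (hu : u ∉ s.processed)
    (h₁ : v₁ ∉ s.processed) (h₂ : v₂ ∉ s.processed) (hw : w ∉ s.processed) :
    (body2 s (u, v₁, v₂, w)).processed = s.processed ∪ {u, v₁, v₂, w} := by
  simp [body2, hu, h₁, h₂, hw]

/-- The vertices that are set to 1 in step 1 have a neighbour of degree 1 that is set to 0. -/
def RoundState.HasLeaves (G : Multigraph V) (s : RoundState V) : Prop :=
  ∀ u ∈ s.processed, s.y u = 1 → ∃ v ∈ s.processed, G.deg v = 1 ∧ G.Adj v u ∧ s.y v = 0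

/-- A visit reverses an earlier assignment only if both ends of the edge have degree 1. The edge is
then a whole component and the last visit decides. -/
theorem body1_invariant {s : RoundState V} {p : V × V} (hp : p ∈ cands1 G)
    (hs : s.Valid G x ∧ s.HasLeaves G) :
    (body1 s p).Valid G x ∧ (body1 s p).HasLeaves G := by
  obtain ⟨v, u⟩ := p
  obtain ⟨hv : G.deg v = 1, hvu : G.Adj v u⟩ := hp
  obtain ⟨hs, hl⟩ := hs
  have huv := Multigraph.ne_of_deg_eq_one hv hvu
  have hN : ∀ t, G.Adj v t → t = u := fun t => Multigraph.eq_of_deg_eq_one hv hvu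
  refine ⟨⟨?_, ?_, ?_⟩, ?_⟩
  · intro t ht
    have := hs.unprocessed t
    simp only [body1, Function.update_apply] at ht ⊢
    grind
  · intro t ht
    have := hs.binary t
    simp only [body1, Function.update_apply] at ht ⊢
    grind
  · intro z hz hz0 t hzt
    have h1 := hs.zero z
    have h2 := hzt.symm
    simp only [body1, Function.update_apply] at hz hz0 ⊢
    grind
  · intro z hz hz1
    have h1 := hl z
    simp only [body1, Function.update_apply] at hz hz1 ⊢
    by_cases hzu : z = u
    · subst hzu
      exact ⟨v, by simp, hv, hvu, by simp [huv.symm]⟩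
    · have hzv : z ≠ v := by rintro rfl; simp [hzu] at hz1
      obtain ⟨l, hl1, hl2, hl3, hl4⟩ := h1 (by grind) (by grind)
      refine ⟨l, by grind, hl2, hl3, ?_⟩
      -- The leaf that serves `z` keeps its value 0: if it were `u`, its only neighbour would be
      -- `v`, while `z ≠ v`.
      have : l ≠ u := by
        rintro rfl
        exact hzv (Multigraph.eq_of_deg_eq_one hl2 hvu.symm hl3)
      grind

/-- How a step of the rounding procedure after the first one changes the state. -/
structure RoundState.Extends (x : V → ℝ) (s s' : RoundState V) : Prop where
  subset : s.processed ⊆ s'.processed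
  agree : ∀ v ∈ s.processed, s'.y v = s.y v
  gain : ∑ v ∈ s.processed, (2 * x v - s.y v) ≤ ∑ v ∈ s'.processed, (2 * x v - s'.y v)

omit [DecidableEq V] in
theorem RoundState.Extends.refl (s : RoundState V) : s.Extends x s :=
  ⟨Finset.Subset.refl _, fun _ _ => rfl, le_rfl⟩

omit [DecidableEq V] in
theorem RoundState.Extends.trans {s s' s'' : RoundState V} (h : s.Extends x s')
    (h' : s'.Extends x s'') : s.Extends x s'' :=
  ⟨h.subset.trans h'.subset,
    fun v hv => (h'.agree v (h.subset hv)).trans (h.agree v hv), h.gain.trans h'.gain⟩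

/-- Values on processed vertices are frozen, so the gain changes only by the newly processed ones.
-/
theorem RoundState.Extends.of_union {s s' : RoundState V} (S : Finset V)
    (hP : s'.processed = s.processed ∪ S) (hy : ∀ v ∈ s.processed, s'.y v = s.y v)
    (hS : 0 ≤ ∑ v ∈ S \ s.processed, (2 * x v - s'.y v)) : s.Extends x s' := by
  refine ⟨by simp [hP], hy, ?_⟩
  rw [hP, ← Finset.union_sdiff_self_eq_union, Finset.sum_union Finset.disjoint_sdiff]
  rw [Finset.sum_congr rfl fun v hv => by rw [← hy v hv]]
  linarith

/-- Without a loop the new vertices contribute `2 x v` plus `2 x t - 1` for each unprocessed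
neighbour `t`, and the constraint on an edge `v t` makes this nonnegative. With a loop, `x v ≥ 1/2`
pays for the value 1. -/
theorem body34_invariant (hx : G.LPFeasible x) {s : RoundState V} {p : V × V × V}
    (hp : p ∈ cands4 G x) (hs : s.Valid G x) :
    (body34 s p).Valid G x ∧ s.Extends x (body34 s p) := by
  obtain ⟨u, v, w⟩ := p
  obtain ⟨-, hdeg, hN⟩ := hp
  by_cases hv : v ∈ s.processed
  · simp only [body34, hv, if_true]
    exact ⟨hs, .refl s⟩
  have hu : G.Adj v u := (hN u).2 (.inl rfl)
  have hw : G.Adj v w := (hN w).2 (.inr rfl)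
  have hxu := hx.2 _ _ hu
  have hxw := hx.2 _ _ hw
  -- A loop uses up both edge ends of `v`, so there is no other neighbour.
  have hloop : u = v ∨ w = v → u = v ∧ w = v := by
    have := fun (h : G.Adj v v) t => Multigraph.eq_of_deg_eq_two_of_loop (t := t) hdeg h
    rintro (rfl | rfl)
    · exact ⟨rfl, this hu _ hw⟩
    · exact ⟨this hw _ hu, rfl⟩
  have hy := body34_y (u := u) (w := w) hv
  have hP := body34_processed (u := u) (w := w) hv
  refine ⟨⟨?_, ?_, ?_⟩, .of_union {u, v, w} hP ?_ ?_⟩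
  · intro t ht
    have := hs.unprocessed t
    rw [hP] at ht
    rw [hy]
    grind
  · intro t ht
    have := hs.binary t
    rw [hP] at ht
    rw [hy]
    grind
  · intro z hz hz0 t hzt
    rw [hP] at hz ⊢
    rw [hy] at hz0 ⊢
    by_cases hzv : z = v
    · subst hzv
      have h1 := (hN t).1 hzt
      have h2 : t ∈ s.processed → s.y t = 1 := fun h => hs.eq_one_of_adj hv h hzt
      grind
    · have h1 := hs.zero z
      have h2 : t = v → z = u ∨ z = w := fun h => (hN z).1 (h ▸ hzt.symm)
      grind
  · intro t ht
    rw [hy]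
    grind
  · have hval : ∀ t ∈ ({u, v, w} : Finset V) \ s.processed, (body34 s (u, v, w)).y t
        = if t = u ∨ t = w then 1 else 0 := by
      intro t ht
      rw [hy]
      grind
    rw [Finset.sum_congr rfl fun t ht => by rw [hval t ht]]
    have h0 := hx.1
    by_cases huv : u = v
    · obtain ⟨rfl, rfl⟩ := hloop (.inl huv)
      rw [Finset.sdiff_eq_self_of_disjoint (by simp [hv])]
      simp
      linarith
    · have hwv : w ≠ v := fun h => huv (hloop (.inr h)).1
      have hsplit : ({u, v, w} : Finset V) \ s.processed
          = insert v (({u, w} : Finset V) \ s.processed) := by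
        ext t; simp; grind
      rw [hsplit, Finset.sum_insert (by simp [Ne.symm huv, hwv.symm])]
      rw [if_neg (by simp [Ne.symm huv, hwv.symm])]
      have h3 : ∀ t ∈ ({u, w} : Finset V) \ s.processed, 1 - 2 * x v ≤ 2 * x t - 1 := by
        intro t ht
        have : t = u ∨ t = w := by grind
        rcases this with rfl | rfl <;> linarith
      have h4 : ∀ t ∈ ({u, w} : Finset V) \ s.processed,
          2 * x t - (if t = u ∨ t = w then (1:ℝ) else 0) = 2 * x t - 1 := by
        intro t ht
        have : t = u ∨ t = w := by grind
        rw [if_pos this]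
      rw [Finset.sum_congr rfl h4]
      by_cases hup : u ∈ s.processed <;> by_cases hwp : w ∈ s.processed
      · rw [Finset.sdiff_eq_empty_iff_subset.2 (by grind)]
        simpa using h0 v
      · rw [Finset.insert_sdiff_of_mem _ hup, Finset.sdiff_eq_self_of_disjoint (by simpa using hwp)]
        simp
        linarith [h0 v]
      · rw [Finset.pair_comm, Finset.insert_sdiff_of_mem _ hwp,
          Finset.sdiff_eq_self_of_disjoint (by simpa using hup)]
        simp
        linarith [h0 v]
      · rw [Finset.sdiff_eq_self_of_disjoint (by simp [hup, hwp])]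
        by_cases huw : u = w
        · subst huw
          simp
          linarith [h0 v]
        · rw [Finset.sum_pair huw]
          linarith [h0 u, h0 w]

/-- The four vertices cost 3, while the disjoint edges `u v₁` and `v₂ w` force the doubled LP mass
on them to be at least 4. Only `v₂` gets 0, and its two neighbours get 1. -/
theorem body2_invariant (hx : G.LPFeasible x) {s : RoundState V} {p : V × V × V × V}
    (hp : p ∈ cands2 G x) (hs : s.Valid G x) :
    (body2 s p).Valid G x ∧ s.Extends x (body2 s p) := by
  obtain ⟨u, v₁, v₂, w⟩ := p
  obtain ⟨hnd, -, huv, hvv, hvw, -, -, hdeg⟩ := hp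
  by_cases hc : u ∉ s.processed ∧ v₁ ∉ s.processed ∧ v₂ ∉ s.processed ∧ w ∉ s.processed
  swap
  · simp only [body2, hc, if_false]
    exact ⟨hs, .refl s⟩
  obtain ⟨hu, h₁, h₂, hw⟩ := hc
  simp only [List.nodup_cons, List.mem_cons, List.not_mem_nil, or_false, not_or] at hnd
  have hN : ∀ t, G.Adj v₂ t → t = v₁ ∨ t = w := fun t =>
    Multigraph.eq_or_eq_of_deg_eq_two hdeg hvv.symm hvw (by tauto)
  have hy := body2_y hu h₁ h₂ hw
  have hP := body2_processed hu h₁ h₂ hw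
  refine ⟨⟨?_, ?_, ?_⟩, .of_union {u, v₁, v₂, w} hP ?_ ?_⟩
  · intro t ht
    have := hs.unprocessed t
    rw [hP] at ht
    rw [hy]
    grind
  · intro t ht
    have := hs.binary t
    rw [hP] at ht
    rw [hy]
    grind
  · intro z hz hz0 t hzt
    rw [hP] at hz ⊢
    rw [hy] at hz0 ⊢
    by_cases hzv : z = v₂
    · subst hzv
      have h1 := hN t hzt
      grind
    · have h1 := hs.zero z
      grind
  · intro t ht
    rw [hy]
    grind
  · rw [Finset.sdiff_eq_self_of_disjoint (by simp [hu, h₁, h₂, hw])]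
    rw [Finset.sum_insert (by simp; tauto), Finset.sum_insert (by simp; tauto),
      Finset.sum_pair (by tauto)]
    have e1 : (body2 s (u, v₁, v₂, w)).y u = 1 := by rw [hy]; grind
    have e2 : (body2 s (u, v₁, v₂, w)).y v₁ = 1 := by rw [hy]; grind
    have e3 : (body2 s (u, v₁, v₂, w)).y v₂ = 0 := by rw [hy]; grind
    have e4 : (body2 s (u, v₁, v₂, w)).y w = 1 := by rw [hy]; grind
    rw [e1, e2, e3, e4]
    linarith [hx.2 _ _ huv, hx.2 _ _ hvw]

omit [DecidableEq V] in
theorem forAll_invariant {ι : Type} {cands : Set ι} {body : RoundState V → ι → RoundState V}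
    (hb : ∀ s : RoundState V, ∀ p ∈ cands, s.Valid G x →
      (body s p).Valid G x ∧ s.Extends x (body s p))
    {s s' : RoundState V} (h : ForAll cands body s s') (hs : s.Valid G x) :
    s'.Valid G x ∧ s.Extends x s' :=
  h.induct (fun t => t.Valid G x ∧ s.Extends x t) ⟨hs, .refl s⟩ fun t p hp ht =>
    ⟨(hb t p hp ht.1).1, ht.2.trans (hb t p hp ht.1).2⟩

theorem step1_processed {s s' : RoundState V} (h : ForAll (cands1 G) body1 s s') {p : V × V}
    (hp : p ∈ cands1 G) : p.1 ∈ s'.processed := by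
  obtain ⟨l, -, hl, rfl⟩ := h
  have hmono : ∀ (l : List (V × V)) (s : RoundState V),
      s.processed ⊆ (l.foldl body1 s).processed := by
    intro l
    induction l with
    | nil => exact fun s => Finset.Subset.refl _
    | cons a l ih => exact fun s => Finset.Subset.trans Finset.subset_union_left (ih (body1 s a))
  have := (hl p).2 hp
  clear hl
  induction l generalizing s with
  | nil => simp at this
  | cons a l ih =>
    rcases List.mem_cons.1 this with rfl | h
    · exact hmono l _ (by simp [body1])
    · exact ih h

/-- The structure of a run of the rounding procedure: the state after step 1 and the
final state. -/
theorem IsRounding.exists_states (hx : G.LPFeasible x) {y : V → ℝ} (h : IsRounding G x y) :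
    ∃ s t : RoundState V, s.Valid G x ∧ s.HasLeaves G ∧
      (∀ p ∈ cands1 G, p.1 ∈ s.processed) ∧ t.Valid G x ∧ s.Extends x t ∧ y = step5 t.y := by
  obtain ⟨s₁, s₂, s₃, s₄, h1, h2, h3, h4, rfl⟩ := h
  obtain ⟨hv1, hl1⟩ := h1.induct (fun t => t.Valid G x ∧ t.HasLeaves G)
    ⟨⟨by simp, by simp, by simp⟩, by simp [RoundState.HasLeaves]⟩
    fun t p hp ht => body1_invariant hp ht
  obtain ⟨hv2, he2⟩ := forAll_invariant (fun s p hp => body2_invariant hx hp) h2 hv1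
  obtain ⟨hv3, he3⟩ := forAll_invariant (fun s p hp => body34_invariant hx hp.1) h3 hv2
  obtain ⟨hv4, he4⟩ := forAll_invariant (fun s p hp => body34_invariant hx hp) h4 hv3
  exact ⟨s₁, s₄, hv1, hl1, fun p hp => step1_processed h1 hp, hv4,
    he2.trans (he3.trans he4), rfl⟩

omit [DecidableEq V] in
theorem step5_eq_of_mem {s : RoundState V} (hs : s.Valid G x) {v : V} (hv : v ∈ s.processed) :
    step5 s.y v = s.y v := by
  rcases hs.binary v hv with h | h <;> norm_num [step5, h]

omit [DecidableEq V] in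
theorem step5_of_not_mem {s : RoundState V} (hs : s.Valid G x) {v : V} (hv : v ∉ s.processed)
    (hx : x v = 0 ∨ x v = 1 / 2 ∨ x v = 1) : step5 s.y v = if x v = 0 then 0 else 1 := by
  rcases hx with h | h | h <;> norm_num [step5, hs.unprocessed v hv, h]

theorem step5_binary {s : RoundState V} (hs : s.Valid G x)
    (hx : ∀ v, x v = 0 ∨ x v = 1 / 2 ∨ x v = 1) (v : V) :
    step5 s.y v = 0 ∨ step5 s.y v = 1 := by
  by_cases hv : v ∈ s.processed
  · rw [step5_eq_of_mem hs hv]; exact hs.binary v hv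
  · rw [step5_of_not_mem hs hv (hx v)]; split_ifs <;> simp

/-- A final 0 at a processed vertex is covered by the invariant. At an unprocessed vertex it means
`x u = 0`; an unprocessed neighbour then has positive LP value and is rounded to 1, and a processed
one is already 1. -/
theorem step5_cover {s : RoundState V} (hs : s.Valid G x) (hf : G.LPFeasible x)
    (hx : ∀ v, x v = 0 ∨ x v = 1 / 2 ∨ x v = 1) {u v : V} (h : G.Adj u v) :
    step5 s.y u = 1 ∨ step5 s.y v = 1 := by
  refine or_iff_not_imp_left.2 fun hu => ?_
  have hu := (step5_binary hs hx u).resolve_right hu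
  by_cases hup : u ∈ s.processed
  · rw [step5_eq_of_mem hs hup] at hu
    obtain ⟨h1, h2⟩ := hs.zero u hup hu v h
    rw [step5_eq_of_mem hs h1, h2]
  · rw [step5_of_not_mem hs hup (hx u)] at hu
    have hu0 : x u = 0 := by simpa using hu
    by_cases hvp : v ∈ s.processed
    · rw [step5_eq_of_mem hs hvp, hs.eq_one_of_adj hup hvp h]
    · have := hf.2 u v h
      rw [step5_of_not_mem hs hvp (hx v), if_neg]
      intro h0
      norm_num [hu0, h0] at this

theorem IsAlgorithmOutput.exists_cover {n : ℕ} {G : Multigraph (Fin n)} {y : Fin n → ℝ}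
    (h : IsAlgorithmOutput G y) :
    ∃ C : Finset (Fin n), G.IsVertexCover C ∧ ∀ v, y v = if v ∈ C then 1 else 0 := by
  obtain ⟨x, ⟨hx, hf, -⟩, hr⟩ := h
  obtain ⟨s, t, -, -, -, ht, -, rfl⟩ := hr.exists_states hf
  classical
  refine ⟨Finset.univ.filter fun v => step5 t.y v = 1, fun e he => ?_, fun v => ?_⟩
  · induction e with
    | h u v =>
      rcases step5_cover ht hf hx (show G.Adj u v from he) with h | h
      · exact ⟨u, by simpa using h, by simp⟩
      · exact ⟨v, by simpa using h, by simp⟩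
  · rcases step5_binary ht hx v with h | h <;> simp [h]

/-- A bound for every output of the algorithm in terms of the number `a` of the vertices of
degree 1 that are set to 1 in step 1 and the number `b` of the other vertices that are set to 1
in step 1. -/
theorem IsAlgorithmOutput.bounds [Fintype V] {y : V → ℝ} (h : IsAlgorithmOutput G y) :
    ∃ a b : ℕ, ∑ v, y v ≤ a + #{v | G.deg v ≠ 1} ∧ ∑ v, y v + a + b ≤ 2 * G.opt ∧
      ∀ D, #{v | G.deg v = 1} ≤ 2 * a + D * b + ∑ v, (G.deg v - D) := by
  obtain ⟨x, hopt, hr⟩ := h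
  obtain ⟨hx, hf, -⟩ := id hopt
  obtain ⟨s, t, hs, hl, hc, ht, hst, rfl⟩ := hr.exists_states hf
  classical
  set H := s.processed.filter fun v => s.y v = 1 with hH
  have hbin := step5_binary ht hx
  have hle1 : ∀ v, step5 t.y v ≤ 1 := fun v => by rcases hbin v with h | h <;> rw [h] <;> norm_num
  have hleaf : ∀ v, G.deg v = 1 → v ∈ s.processed := fun v hv => by
    obtain ⟨u, hu⟩ := Multigraph.exists_adj_of_deg_ne_zero (G := G) (v := v) (by omega)
    exact hc (v, u) ⟨hv, hu⟩
  have hsum : ∑ v ∈ s.processed, s.y v = #H := by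
    rw [hH, Finset.card_filter, Nat.cast_sum]
    refine Finset.sum_congr rfl fun v hv => ?_
    rcases hs.binary v hv with h | h <;> simp [h]
  refine ⟨#(H.filter fun v => G.deg v = 1), #(H.filter fun v => G.deg v ≠ 1), ?_, ?_, ?_⟩
  -- All vertices of degree 1 are processed in step 1 and keep their values, so exactly `a` of them
  -- end at 1; the others are bounded by 1 each.
  · rw [← Finset.sum_filter_add_sum_filter_not Finset.univ (fun v => G.deg v = 1)]
    refine add_le_add (le_of_eq ?_) ?_
    · rw [hH, Finset.filter_filter, Finset.card_filter, Nat.cast_sum]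
      have : (Finset.univ.filter fun v => G.deg v = 1) ⊆ s.processed := fun v hv =>
        hleaf v (by simpa using hv)
      rw [← Finset.sum_subset this]
      · refine Finset.sum_congr rfl fun v hv => ?_
        have hvd : G.deg v = 1 := by simpa using hv
        have hvs := this hv
        rw [step5_eq_of_mem ht (hst.subset hvs), hst.agree v hvs]
        rcases hs.binary v hvs with h | h <;> simp [h, hvd]
      · intro v _ hv
        simp at hv
        simp [hv]
    · refine (Finset.sum_le_sum fun v _ => hle1 v).trans ?_
      simp
  · have h1 : ∑ v, step5 t.y v ≤ ∑ v ∈ t.processed, t.y v + ∑ v ∈ t.processedᶜ, 2 * x v := by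
      rw [← Finset.sum_add_sum_compl t.processed]
      refine add_le_add (le_of_eq (Finset.sum_congr rfl fun v hv => step5_eq_of_mem ht hv))
        (Finset.sum_le_sum fun v hv => ?_)
      rw [step5_of_not_mem ht (by simpa using hv) (hx v)]
      rcases hx v with h | h | h <;> norm_num [h]
    -- Pair each vertex of `H` with a leaf of value 0. Distinct vertices get distinct leaves, as a
    -- leaf has one neighbour, and each pair has LP mass at least 1.
    have h2 : (#H : ℝ) ≤ ∑ v ∈ s.processed, x v := by
      have : ∀ u : V, ∃ v, u ∈ H → v ∈ s.processed ∧ G.deg v = 1 ∧ G.Adj v u ∧ s.y v = 0 := by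
        intro u
        by_cases hu : u ∈ H
        · obtain ⟨v, hv⟩ := hl u (Finset.mem_filter.1 hu).1 (Finset.mem_filter.1 hu).2
          exact ⟨v, fun _ => hv⟩
        · exact ⟨u, fun h => absurd h hu⟩
      choose ℓ hℓ using this
      have hinj : Set.InjOn ℓ H := fun u hu u' hu' he => by
        have h1 := hℓ u hu
        have h2 := hℓ u' hu'
        rw [← he] at h2
        exact Multigraph.eq_of_deg_eq_one h1.2.1 h2.2.2.1 h1.2.2.1
      have hdisj : Disjoint H (H.image ℓ) := by
        rw [Finset.disjoint_left]
        intro v hv hv'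
        obtain ⟨u, hu, rfl⟩ := Finset.mem_image.1 hv'
        have h1 := (hℓ u hu).2.2.2
        have h2 := (Finset.mem_filter.1 hv).2
        rw [h1] at h2
        norm_num at h2
      calc (#H : ℝ) = ∑ u ∈ H, 1 := by simp
        _ ≤ ∑ u ∈ H, (x u + x (ℓ u)) := Finset.sum_le_sum fun u hu => by
            have := hf.2 _ _ (hℓ u hu).2.2.1
            linarith
        _ = ∑ v ∈ H ∪ H.image ℓ, x v := by
            rw [Finset.sum_union hdisj, Finset.sum_image hinj, Finset.sum_add_distrib]
        _ ≤ _ := by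
            refine Finset.sum_le_sum_of_subset_of_nonneg (Finset.union_subset
              (Finset.filter_subset _ _) fun v hv => ?_) fun v _ _ => hf.1 v
            obtain ⟨u, hu, rfl⟩ := Finset.mem_image.1 hv
            exact (hℓ u hu).1
    have h3 := hst.gain
    have h4 := hopt.sum_le_opt
    rw [← Finset.sum_add_sum_compl t.processed] at h4
    have h5 : ((#(H.filter fun v => G.deg v = 1) : ℕ) : ℝ) + #(H.filter fun v => G.deg v ≠ 1)
        = #H := by
      rw [← Nat.cast_add, Finset.card_filter_add_card_filter_not]
    rw [Finset.sum_sub_distrib, Finset.sum_sub_distrib, ← Finset.mul_sum, ← Finset.mul_sum,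
      hsum] at h3
    rw [← Finset.mul_sum] at h1
    linarith
  · intro D
    -- A leaf of value 0 has a neighbour of value 1, which lies in `H`.
    have h1 : (Finset.univ.filter fun v => G.deg v = 1) ⊆ H.filter (fun v => G.deg v = 1) ∪
        H.biUnion fun u => Finset.univ.filter fun v => G.Adj u v := by
      intro v hv
      have hv : G.deg v = 1 := by simpa using hv
      have hvs := hleaf v hv
      simp only [Finset.mem_union, Finset.mem_filter, Finset.mem_biUnion, hH, Finset.mem_univ,
        true_and]
      rcases hs.binary v hvs with h | h
      · obtain ⟨u, hu⟩ := Multigraph.exists_adj_of_deg_ne_zero (G := G) (v := v) (by omega)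
        exact .inr ⟨u, hs.zero v hvs h u hu, hu.symm⟩
      · exact .inl ⟨⟨hvs, h⟩, hv⟩
    have h2 : #(H.biUnion fun u => Finset.univ.filter fun v => G.Adj u v) ≤ ∑ u ∈ H, G.deg u :=
      Finset.card_biUnion_le.trans (Finset.sum_le_sum fun u _ =>
        G.card_neighbors_le_deg u _ (by simp))
    have h3 : ∑ u ∈ H, G.deg u ≤ #(H.filter fun v => G.deg v = 1)
        + (D * #(H.filter fun v => G.deg v ≠ 1) + ∑ v, (G.deg v - D)) := by
      rw [← Finset.sum_filter_add_sum_filter_not H (fun v => G.deg v = 1)]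
      refine add_le_add ?_ ?_
      · rw [Finset.card_eq_sum_ones]
        exact Finset.sum_le_sum fun v hv => (Finset.mem_filter.1 hv).2.le
      · calc _ ≤ ∑ v ∈ H.filter (fun v => G.deg v ≠ 1), (D + (G.deg v - D)) :=
              Finset.sum_le_sum fun v _ => by omega
          _ ≤ _ := by
              rw [Finset.sum_add_distrib, Finset.sum_const, smul_eq_mul, mul_comm]
              gcongr
              exact Finset.subset_univ _
    have := (Finset.card_le_card h1).trans (Finset.card_union_le _ _)
    omega

end Rounding

/-! ### The random graph has the prescribed degrees -/

/-- Count the copies of `v` edge by edge: the fibre of the map from copies to matched pairs is `{h,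
σ h}`, and it contains as many copies of `v` as the edge has ends at `v`, two in the case of a loop.
-/
theorem deg_matchingGraph {n : ℕ} {d : Fin n → ℕ}
    (σ : PerfectMatching (Σ v : Fin n, Fin (d v))) (v : Fin n) : (matchingGraph σ).deg v = d v := by
  set w : (Σ v : Fin n, Fin (d v)) → ℕ := fun h => if h.1 = v then 1 else 0 with hw
  have h1 : (matchingGraph σ).deg v
      = ∑ e ∈ Finset.univ.image fun h => s(h, σ.1 h),
          Multiset.count v (Sym2.map Sigma.fst e).toMultiset := by
    simp only [Multigraph.deg, matchingGraph, Multiset.map_map, Finset.sum, Function.comp_def]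
  have h2 : ∑ h, w h = d v := by
    have : ∀ u : Fin n, ∑ _k : Fin (d u), (if u = v then 1 else 0) = if u = v then d v else 0 := by
      intro u
      split_ifs with h <;> simp [h]
    rw [hw, Fintype.sum_sigma]
    simp only [this]
    simp
  rw [h1, ← h2, ← Finset.sum_fiberwise_of_maps_to
    (g := fun h => s(h, σ.1 h)) (t := Finset.univ.image fun h => s(h, σ.1 h))
    (fun h _ => Finset.mem_image_of_mem _ (Finset.mem_univ h))]
  refine Finset.sum_congr rfl fun e he => ?_
  obtain ⟨h, -, rfl⟩ := Finset.mem_image.1 he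
  have hfib : (Finset.univ.filter fun h' => s(h', σ.1 h') = s(h, σ.1 h)) = {h, σ.1 h} := by
    ext h'
    simp only [Finset.mem_filter, Finset.mem_univ, true_and, Finset.mem_insert,
      Finset.mem_singleton, Sym2.eq_iff]
    have := (σ.2 h).1
    constructor
    · rintro (h | h)
      · exact .inl h.1
      · exact .inr h.1
    · rintro (rfl | rfl)
      · exact .inl ⟨rfl, rfl⟩
      · exact .inr ⟨rfl, this⟩
  rw [hfib, Finset.sum_pair (σ.2 h).2.symm]
  have : (Sym2.map Sigma.fst s(h, σ.1 h)).toMultiset = {h.1, (σ.1 h).1} := rfl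
  rw [this, hw]
  have e : ({h.1, (σ.1 h).1} : Multiset (Fin n)) = h.1 ::ₘ {(σ.1 h).1} := rfl
  rw [e, Multiset.count_cons, Multiset.count_singleton]
  simp only [eq_comm, add_comm]

theorem sum_prescribedDeg_eq (α β : ℝ) (f : ℕ → ℕ) :
    ∑ v, f (prescribedDeg α β v) = ∑ i ∈ Finset.Icc 1 (maxDeg α β), degCount α β i * f i := by
  have h1 : ∑ v, f (prescribedDeg α β v)
      = ∑ i : Fin (maxDeg α β), degCount α β (i + 1) * f (i + 1) := by
    unfold prescribedDeg numVertices
    rw [← Equiv.sum_comp finSigmaFinEquiv]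
    simp only [Equiv.symm_apply_apply]
    rw [Fintype.sum_sigma]
    simp
  rw [h1, Fin.sum_univ_eq_sum_range (fun i => degCount α β (i + 1) * f (i + 1)),
    Finset.range_eq_Ico, Finset.sum_Ico_add' (fun j => degCount α β j * f j) 0 _ 1]
  rfl

theorem degCount_le (α β : ℝ) {i : ℕ} (hi : 1 < i) :
    (degCount α β i : ℝ) ≤ Real.exp α * (i : ℝ) ^ (-β) := by
  rw [degCount, if_pos (.inl hi), rawCount, Real.rpow_neg (by positivity), ← div_eq_mul_inv]
  exact Nat.floor_le (by positivity)

theorem le_degCount_one (α β : ℝ) : Real.exp α - 1 ≤ degCount α β 1 := by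
  have h : Real.exp α - 1 ≤ rawCount α β 1 := by
    have := (Nat.lt_floor_add_one (Real.exp α)).le
    simp [rawCount]
    linarith
  unfold degCount
  split_ifs
  · exact h
  · push_cast; linarith

theorem one_le_maxDeg {α β : ℝ} (hα : 0 ≤ α) (hβ : 0 ≤ β) : 1 ≤ maxDeg α β := by
  rw [maxDeg, Nat.one_le_floor_iff, Real.one_le_exp_iff]
  positivity

/-! ### Sums of powers -/

/-- The midpoint rule underestimates the integral of a negative power. -/
theorem mul_rpow_le_sub_rpow {x r : ℝ} (hx : 1 / 2 < x) (hr : 0 < r) :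
    r * x ^ (-(r + 1)) ≤ (x - 1 / 2) ^ (-r) - (x + 1 / 2) ^ (-r) := by
  -- `g 0 = 0` and the claim is `g (1/2) ≥ 0`, so monotonicity of `g` suffices.
  set g : ℝ → ℝ := fun t => (x - t) ^ (-r) - (x + t) ^ (-r) - 2 * r * x ^ (-(r + 1)) * t with hg
  have hd : ∀ t ∈ Set.Icc (0:ℝ) (1 / 2), HasDerivAt g
      (r * (x - t) ^ (-(r + 1)) + r * (x + t) ^ (-(r + 1)) - 2 * r * x ^ (-(r + 1))) t := by
    intro t ht
    have h1 : HasDerivAt (fun t : ℝ => x - t) (-1) t := by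
      simpa using (hasDerivAt_id t).const_sub x
    have h2 : HasDerivAt (fun t : ℝ => x + t) 1 t := by
      simpa using (hasDerivAt_id t).const_add x
    have h3 := h1.rpow_const (p := -r) (.inl (by linarith [ht.2]))
    have h4 := h2.rpow_const (p := -r) (.inl (by linarith [ht.1]))
    have h5 := (h3.sub h4).sub ((hasDerivAt_id t).const_mul (2 * r * x ^ (-(r + 1))))
    rw [show -r - 1 = -(r + 1) by ring] at h5
    exact h5.congr_deriv (by ring)
  have hmono : MonotoneOn g (Set.Icc 0 (1 / 2)) := by
    refine monotoneOn_of_deriv_nonneg (convex_Icc _ _)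
      (fun t ht => (hd t ht).continuousAt.continuousWithinAt)
      (fun t ht => (hd t (interior_subset ht)).differentiableAt.differentiableWithinAt) ?_
    intro t ht
    have ht' := interior_subset ht
    rw [(hd t ht').deriv]
    have ha : 0 < x - t := by linarith [ht'.2]
    have hb : 0 < x + t := by linarith [ht'.1]
    -- Halving the exponent turns midpoint convexity into the inequality of arithmetic and geometric
    -- means, together with `(x - t)(x + t) ≤ x²`.
    set q := (r + 1) / 2
    have hq : -(r + 1) = -q + -q := by simp only [q]; ring
    have e : ∀ a : ℝ, 0 < a → a ^ (-(r + 1)) = a ^ (-q) * a ^ (-q) := fun a h => by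
      rw [hq, Real.rpow_add h]
    have h1 : x ^ (-q) * x ^ (-q) ≤ (x - t) ^ (-q) * (x + t) ^ (-q) := by
      rw [← Real.mul_rpow (by linarith) (by linarith), ← Real.mul_rpow ha.le hb.le]
      refine Real.rpow_le_rpow_of_nonpos (by positivity) (by nlinarith [sq_nonneg t]) ?_
      simp only [q]; linarith
    rw [e _ ha, e _ hb, e x (by linarith)]
    have := sq_nonneg ((x - t) ^ (-q) - (x + t) ^ (-q))
    have h2 : 2 * (x ^ (-q) * x ^ (-q))
        ≤ (x - t) ^ (-q) * (x - t) ^ (-q) + (x + t) ^ (-q) * (x + t) ^ (-q) := by nlinarith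
    nlinarith
  have := hmono (Set.left_mem_Icc.2 (by norm_num)) (Set.right_mem_Icc.2 (by norm_num))
    (by norm_num)
  simp only [hg, sub_zero, add_zero, mul_zero, sub_self] at this
  linarith

/-- The midpoint rule compares the tail with the integral of `t^(-s)` from `k + 1/2`; the estimate
telescopes. Starting at `k + 1/2` rather than at `k` gives the precision needed in `realZeta_bound`.
-/
theorem sum_rpow_tail_le {s : ℝ} (hs : 1 < s) (k M : ℕ) :
    ∑ i ∈ Finset.Ioc k M, (i : ℝ) ^ (-s) ≤ (k + 1 / 2 : ℝ) ^ (1 - s) / (s - 1) := by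
  have hs' : 0 < s - 1 := by linarith
  by_cases hkM : M ≤ k
  · rw [Finset.Ioc_eq_empty_of_le hkM, Finset.sum_empty]
    positivity
  suffices h : ∑ i ∈ Finset.Ioc k M, (i : ℝ) ^ (-s)
      ≤ ((k + 1 / 2 : ℝ) ^ (1 - s) - (M + 1 / 2 : ℝ) ^ (1 - s)) / (s - 1) by
    refine h.trans ?_
    gcongr
    have : (0:ℝ) ≤ (M + 1 / 2 : ℝ) ^ (1 - s) := by positivity
    linarith
  have hkM : k ≤ M := by omega
  induction M, hkM using Nat.le_induction with
  | base => simp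
  | succ M hM ih =>
    have h1 : k < M + 1 := by omega
    rw [← Finset.insert_Ioc_right_eq_Ioc_add_one hM, Finset.sum_insert (by simp)]
    have h2 : ∑ i ∈ Finset.Ioc k M, (i : ℝ) ^ (-s)
      ≤ ((k + 1 / 2 : ℝ) ^ (1 - s) - (M + 1 / 2 : ℝ) ^ (1 - s)) / (s - 1) := by
      by_cases h : M ≤ k
      · obtain rfl : M = k := le_antisymm h hM
        simp
      · exact ih h
    have h3 := mul_rpow_le_sub_rpow (x := (M + 1 : ℕ)) (r := s - 1)
      (by push_cast; linarith [(Nat.cast_nonneg M : (0:ℝ) ≤ M)]) hs'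
    rw [show -(s - 1 + 1) = -s by ring, show -(s - 1) = 1 - s by ring,
      show ((M + 1 : ℕ) : ℝ) - 1 / 2 = M + 1 / 2 by push_cast; ring] at h3
    rw [le_div_iff₀ hs'] at h2 ⊢
    linarith

/-- The excess sum is the sum of the tails beyond `k` over all `k ≥ D`. Each tail is at most `(k +
1/2)^(1-s) / (s - 1)`, and a second use of the midpoint rule sums these to an integral from `D`. -/
theorem sum_excess_rpow_le {s : ℝ} (hs : 2 < s) {D : ℕ} (hD : 1 ≤ D) (M : ℕ) :
    ∑ i ∈ Finset.Ioc D M, ((i - D : ℕ) : ℝ) * (i : ℝ) ^ (-s)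
      ≤ (D : ℝ) ^ (2 - s) / ((s - 1) * (s - 2)) := by
  have h1 : 0 < s - 1 := by linarith
  have h2 : 0 < s - 2 := by linarith
  -- Induction downwards in `D`, with `j` as a bound for `M - D`.
  obtain ⟨j, hj⟩ : ∃ j, M ≤ D + j := ⟨M, by omega⟩
  induction j generalizing D with
  | zero =>
    rw [Finset.Ioc_eq_empty_of_le (by omega), Finset.sum_empty]
    positivity
  | succ j ih =>
    by_cases hDM : M ≤ D
    · rw [Finset.Ioc_eq_empty_of_le hDM, Finset.sum_empty]
      positivity
    have hsplit : ∑ i ∈ Finset.Ioc D M, ((i - D : ℕ) : ℝ) * (i : ℝ) ^ (-s)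
        = ∑ i ∈ Finset.Ioc (D + 1) M, ((i - (D + 1) : ℕ) : ℝ) * (i : ℝ) ^ (-s)
          + ∑ i ∈ Finset.Ioc D M, (i : ℝ) ^ (-s) := by
      rw [← Finset.insert_Ioc_add_one_left_eq_Ioc (by omega), Finset.sum_insert (by simp),
        Finset.sum_insert (by simp), add_left_comm, ← Finset.sum_add_distrib]
      congr 1
      · simp
      · refine Finset.sum_congr rfl fun i hi => ?_
        have : D + 1 < i := (Finset.mem_Ioc.1 hi).1
        rw [show i - D = i - (D + 1) + 1 by omega]
        push_cast
        ring
    have h3 := ih (D := D + 1) (by omega) (by omega)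
    have h4 := sum_rpow_tail_le (s := s) (by linarith) D M
    have hD' : (1:ℝ) ≤ D := by exact_mod_cast hD
    have h5 := mul_rpow_le_sub_rpow (x := (D + 1 / 2 : ℝ)) (r := s - 2) (by linarith) h2
    rw [show -(s - 2 + 1) = 1 - s by ring, show -(s - 2) = 2 - s by ring,
      show (D : ℝ) + 1 / 2 - 1 / 2 = D by ring, show (D : ℝ) + 1 / 2 + 1 / 2 = (D + 1 : ℕ) by
        push_cast; ring] at h5
    rw [hsplit]
    refine (add_le_add h3 h4).trans ?_
    rw [div_add_div _ _ (by positivity) (by positivity), div_le_div_iff₀ (by positivity)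
      (by positivity)]
    have : 0 < (s - 1) * (s - 1) * (s - 2) := by positivity
    nlinarith [mul_le_mul_of_nonneg_left h5 this.le]

/-! ### The zeta function at real arguments -/

theorem hasSum_realZeta {s : ℝ} (hs : 1 < s) :
    HasSum (fun n : ℕ => ((n + 1 : ℕ) : ℝ) ^ (-s)) (realZeta s) := by
  have hs' : 1 < (s : ℂ).re := by simpa using hs
  have hsum : Summable fun n : ℕ => 1 / ((n : ℂ) + 1) ^ (s : ℂ) := by
    have := (Complex.summable_one_div_nat_cpow (p := (s : ℂ))).2 hs'
    have := (summable_nat_add_iff 1).2 this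
    simpa using this
  have h := hsum.hasSum
  rw [← zeta_eq_tsum_one_div_nat_add_one_cpow hs'] at h
  convert Complex.hasSum_re h using 2 with n
  swap
  · rfl
  have : ((n : ℂ) + 1) = (((n + 1 : ℕ) : ℝ) : ℂ) := by push_cast; rfl
  rw [this, ← Complex.ofReal_cpow (by positivity), ← Complex.ofReal_one, ← Complex.ofReal_div,
    Complex.ofReal_re, Real.rpow_neg (by positivity), one_div]

theorem sum_range_le_realZeta {s : ℝ} (hs : 1 < s) (M : ℕ) :
    ∑ i ∈ Finset.range M, ((i + 1 : ℕ) : ℝ) ^ (-s) ≤ realZeta s :=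
  sum_le_hasSum _ (fun _ _ => by positivity) (hasSum_realZeta hs)

theorem sum_Ioc_one_le_realZeta {s : ℝ} (hs : 1 < s) (M : ℕ) :
    ∑ i ∈ Finset.Ioc 1 M, (i : ℝ) ^ (-s) ≤ realZeta s - 1 := by
  have h := sum_range_le_realZeta hs (M + 1)
  rw [Finset.sum_range_succ'] at h
  simp only [zero_add, Nat.cast_one, Real.one_rpow] at h
  refine le_trans ?_ (le_sub_iff_add_le.2 h)
  rw [Finset.range_eq_Ico, Finset.sum_Ico_add' (fun i : ℕ => ((i + 1 : ℕ) : ℝ) ^ (-s)) 0 M 1,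
    Finset.sum_Ico_add' (fun i : ℕ => (i : ℝ) ^ (-s)) _ _ 1]
  refine Finset.sum_le_sum_of_subset_of_nonneg (fun i hi => ?_) fun _ _ _ => by positivity
  simp only [Finset.mem_Ioc, Finset.mem_Ico] at *
  omega

theorem lt_realZeta {s : ℝ} (hs : 1 < s) : 1 + (2:ℝ) ^ (-s) < realZeta s := by
  have h := sum_range_le_realZeta hs 3
  have h3 : (0:ℝ) < (3:ℝ) ^ (-s) := by positivity
  norm_num [Finset.sum_range_succ] at h
  linarith

/-- The first two terms are kept exactly, since the numerical bound needs `ζ(β) - 1 - 2^(-β)`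
sharply; the tail starts at `5/2`. -/
theorem realZeta_le {s : ℝ} (hs : 1 < s) :
    realZeta s ≤ 1 + (2:ℝ) ^ (-s) + (5 / 2 : ℝ) ^ (1 - s) / (s - 1) := by
  refine le_of_tendsto (hasSum_realZeta hs).tendsto_sum_nat ?_
  filter_upwards [eventually_ge_atTop 2] with M hM
  have h := sum_rpow_tail_le hs 2 M
  obtain ⟨j, rfl⟩ := Nat.exists_eq_add_of_le hM
  rw [add_comm 2 j, Finset.sum_range_succ', Finset.sum_range_succ']
  have h2 : ∑ i ∈ Finset.range j, ((i + 1 + 1 + 1 : ℕ) : ℝ) ^ (-s)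
      = ∑ i ∈ Finset.Ioc 2 (2 + j), (i : ℝ) ^ (-s) := by
    rw [Finset.range_eq_Ico, Finset.sum_Ico_add' (fun i : ℕ => (i : ℝ) ^ (-s)) 0 j 3]
    refine Finset.sum_congr ?_ fun _ _ => rfl
    ext i
    simp only [Finset.mem_Ioc, Finset.mem_Ico]
    omega
  norm_num at h h2 ⊢
  rw [h2]
  linarith

/-! ### Comparison of the ratios -/

/-- With `W = ζ(β-1)` and `q` the cubed quotient, the claim reduces to `1 / (2^β W) < 1 - q³`. It
follows from `q³ ≤ q < 1 - 1/W` and `2^β ≥ 1`. -/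
theorem refinedRatio_lt_firstRatio {β : ℝ} (hβ : 2 < β) : refinedRatio β < firstRatio β := by
  have h1 := lt_realZeta (s := β) (by linarith)
  have h2 := lt_realZeta (s := β - 1) (by linarith)
  rw [show -(β - 1) = 1 - β by ring] at h2
  have hp : 0 < (2:ℝ) ^ (-β) := by positivity
  have hp' : 0 < (2:ℝ) ^ (1 - β) := by positivity
  unfold refinedRatio firstRatio
  set Z := realZeta β
  set W := realZeta (β - 1)
  set q := (W - 1 - (2:ℝ) ^ (1 - β)) / W
  have hZ : 0 < Z := by linarith
  have hW : 0 < W := by linarith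
  have hq0 : 0 ≤ q := div_nonneg (by linarith) hW.le
  have hq : q < 1 - 1 / W := by
    rw [show 1 - 1 / W = (W - 1) / W by field_simp]
    exact div_lt_div_of_pos_right (by linarith) hW
  have hq1 : q < 1 := hq.trans (by simp [hW])
  have hq3 : q ^ 3 ≤ q := pow_le_of_le_one hq0 hq1.le (by norm_num)
  have hpow : 1 ≤ (2:ℝ) ^ β := Real.one_le_rpow (by norm_num) (by linarith)
  have e : (Z - 1 - (2:ℝ) ^ (-β)) / ((2:ℝ) ^ β * W * Z)
      = (Z - 1 - (2:ℝ) ^ (-β)) / Z * (1 / ((2:ℝ) ^ β * W)) := by field_simp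
  rw [e]
  refine sub_lt_sub_left (mul_lt_mul_of_pos_left ?_ (div_pos (by linarith) hZ)) 2
  calc 1 / ((2:ℝ) ^ β * W) ≤ 1 / W := one_div_le_one_div_of_le hW (by nlinarith)
    _ < 1 - q ^ 3 := by linarith

/-- The bracket in `ρ'` is at most 1, so it is enough to prove the smaller ratio obtained by
replacing it by 1. -/
theorem two_sub_le_refinedRatio {β : ℝ} (hβ : 2 < β) :
    2 - (realZeta β - 1 - (2:ℝ) ^ (-β)) / realZeta β ≤ refinedRatio β := by
  have h1 := lt_realZeta (s := β) (by linarith)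
  have h2 := lt_realZeta (s := β - 1) (by linarith)
  rw [show -(β - 1) = 1 - β by ring] at h2
  have hp : 0 < (2:ℝ) ^ (-β) := by positivity
  have hp' : 0 < (2:ℝ) ^ (1 - β) := by positivity
  unfold refinedRatio
  refine sub_le_sub_left (mul_le_of_le_one_right (div_nonneg (by linarith) (by linarith)) ?_) 2
  have : 0 ≤ (realZeta (β - 1) - 1 - (2:ℝ) ^ (1 - β)) / realZeta (β - 1) :=
    div_nonneg (by linarith) (by linarith)
  have := pow_nonneg this 3
  linarith

/-- The numerical inequality behind the approximation ratio. -/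
theorem realZeta_bound {β : ℝ} (hβ : 2.424 < β) :
    (realZeta β - 1 - (2:ℝ) ^ (-β)) * (realZeta β - 1) + 1 / 4000
      ≤ (1 - (8:ℝ) ^ (2 - β) / ((β - 1) * (β - 2))) / 4 := by
  have h1 := lt_realZeta (s := β) (by linarith)
  have h2 := realZeta_le (s := β) (by linarith)
  -- All powers decrease in `β`. They are evaluated at rational points below 2.424, namely `12/5`
  -- and `29/12`, where a 5th or 12th power makes the exponent an integer.
  have hp : (2:ℝ) ^ (-β) ≤ 0.1896 := by
    calc (2:ℝ) ^ (-β) ≤ (2:ℝ) ^ (-(12 / 5) : ℝ) :=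
          Real.rpow_le_rpow_of_exponent_le (by norm_num) (by linarith)
      _ ≤ 0.1896 := by
          rw [← Real.rpow_le_rpow_iff (z := 5) (by positivity) (by norm_num) (by norm_num),
            ← Real.rpow_mul (by norm_num)]
          norm_num
  have hA : (5 / 2 : ℝ) ^ (1 - β) / (β - 1) ≤ 0.1948 := by
    have : (5 / 2 : ℝ) ^ (1 - β) ≤ 0.2773 := by
      calc (5 / 2 : ℝ) ^ (1 - β) ≤ (5 / 2 : ℝ) ^ (-(7 / 5) : ℝ) :=
            Real.rpow_le_rpow_of_exponent_le (by norm_num) (by linarith)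
        _ ≤ 0.2773 := by
            rw [← Real.rpow_le_rpow_iff (z := 5) (by positivity) (by norm_num) (by norm_num),
              ← Real.rpow_mul (by norm_num)]
            norm_num
    rw [div_le_iff₀ (by linarith)]
    linarith
  -- The denominator is estimated at 2.424 itself, as the final comparison leaves little room.
  have hT : (8:ℝ) ^ (2 - β) / ((β - 1) * (β - 2)) ≤ 0.6965 := by
    have : (8:ℝ) ^ (2 - β) ≤ 0.4205 := by
      calc (8:ℝ) ^ (2 - β) ≤ (8:ℝ) ^ (-(5 / 12) : ℝ) :=
            Real.rpow_le_rpow_of_exponent_le (by norm_num) (by linarith)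
        _ ≤ 0.4205 := by
            rw [← Real.rpow_le_rpow_iff (z := 12) (by positivity) (by norm_num) (by norm_num),
              ← Real.rpow_mul (by norm_num)]
            norm_num
    rw [div_le_iff₀ (by nlinarith)]
    nlinarith
  set Z := realZeta β
  have h3 : Z - 1 - (2:ℝ) ^ (-β) ≤ 0.1948 := by linarith
  have h4 : Z - 1 ≤ 0.3844 := by linarith
  have hp0 : 0 < (2:ℝ) ^ (-β) := by positivity
  have h5 : (Z - 1 - (2:ℝ) ^ (-β)) * (Z - 1) ≤ 0.1948 * 0.3844 :=
    mul_le_mul h3 h4 (by linarith) (by norm_num)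
  linarith

/-! ### The approximation ratio -/

/-- The bound holds for each matching separately. A large `a + b` is a surplus in `y(V) + a + b ≤ 2
OPT`, and the counts of leaves and of all other vertices show that `a + b` is large compared with
`y(V)`. -/
theorem ratio_le_refinedRatio {α β : ℝ} (hβ : 2.424 < β) (hα : 0 ≤ α) (hexp : 1000 ≤ Real.exp α)
    (σ : PerfectMatching (Copies α β)) {y : Fin (numVertices α β) → ℝ}
    (h : IsAlgorithmOutput (matchingGraph σ) y) :
    (∑ v, y v) / ((matchingGraph σ).opt : ℝ) ≤ refinedRatio β := by
  have hβ1 : 1 < β := by linarith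
  have hβ2 : 2 < β := by linarith
  obtain ⟨a, b, hab, hopt, hD⟩ := h.bounds
  simp only [deg_matchingGraph] at hab hD
  have hmax := one_le_maxDeg (α := α) (β := β) hα (by linarith)
  have hIcc : Finset.Icc 1 (maxDeg α β) = insert 1 (Finset.Ioc 1 (maxDeg α β)) := by
    ext i; simp only [Finset.mem_Icc, Finset.mem_insert, Finset.mem_Ioc]; omega
  have hn1 : Real.exp α - 1 ≤ #{v | prescribedDeg α β v = 1} := by
    rw [Finset.card_filter, sum_prescribedDeg_eq α β (fun i => if i = 1 then 1 else 0), hIcc,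
      Finset.sum_insert (by simp)]
    push_cast
    simp only [mul_one]
    refine (le_degCount_one α β).trans (le_add_of_nonneg_right (by positivity))
  have hn2 : (#{v | prescribedDeg α β v ≠ 1} : ℝ) ≤ Real.exp α * (realZeta β - 1) := by
    rw [Finset.card_filter, sum_prescribedDeg_eq α β (fun i => if i ≠ 1 then 1 else 0), hIcc,
      Finset.sum_insert (by simp)]
    push_cast
    simp only [not_true, if_false, mul_zero, zero_add, ne_eq]
    calc _ ≤ ∑ i ∈ Finset.Ioc 1 (maxDeg α β), Real.exp α * (i : ℝ) ^ (-β) := by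
          refine Finset.sum_le_sum fun i hi => ?_
          have hi : 1 < i := (Finset.mem_Ioc.1 hi).1
          rw [if_pos (by omega), mul_one]
          exact degCount_le α β hi
      _ ≤ _ := by
          rw [← Finset.mul_sum]
          gcongr
          exact sum_Ioc_one_le_realZeta hβ1 _
  have hT : ((∑ v, (prescribedDeg α β v - 8) : ℕ) : ℝ)
      ≤ Real.exp α * ((8:ℝ) ^ (2 - β) / ((β - 1) * (β - 2))) := by
    rw [sum_prescribedDeg_eq α β (fun i => i - 8)]
    have hsub : Finset.Ioc 8 (maxDeg α β) ⊆ Finset.Icc 1 (maxDeg α β) := fun i hi => by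
      simp only [Finset.mem_Ioc, Finset.mem_Icc] at *
      omega
    rw [← Finset.sum_subset hsub fun i hi hi' => by
      simp only [Finset.mem_Ioc, Finset.mem_Icc, not_and, not_le] at *
      rw [Nat.sub_eq_zero_of_le (by omega), mul_zero]]
    push_cast
    calc _ ≤ ∑ i ∈ Finset.Ioc 8 (maxDeg α β), Real.exp α * (((i - 8 : ℕ) : ℝ) * (i : ℝ) ^ (-β)) := by
          refine Finset.sum_le_sum fun i hi => ?_
          have hi : 8 < i := (Finset.mem_Ioc.1 hi).1
          have := degCount_le α β (i := i) (by omega)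
          calc _ ≤ Real.exp α * (i : ℝ) ^ (-β) * ((i - 8 : ℕ) : ℝ) := by gcongr
            _ = _ := by ring
      _ ≤ _ := by
          rw [← Finset.mul_sum]
          gcongr
          exact_mod_cast sum_excess_rpow_le hβ2 (D := 8) (by norm_num) _
  -- Truncating degrees at `D` gives a lower bound on `a + b` of order `N (1 - T) / D`; near `β =
  -- 2.424` the best integer is `D = 8`.
  have h8 : (#{v | prescribedDeg α β v = 1} : ℝ)
      ≤ 2 * a + 8 * b + ((∑ v, (prescribedDeg α β v - 8) : ℕ) : ℝ) := by exact_mod_cast hD 8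
  have hnum := realZeta_bound hβ
  have hz := lt_realZeta hβ1
  refine le_trans ?_ (two_sub_le_refinedRatio hβ2)
  have hp : 0 < (2:ℝ) ^ (-β) := by positivity
  set Z := realZeta β
  set p := (2:ℝ) ^ (-β)
  set N := Real.exp α
  set T := (8:ℝ) ^ (2 - β) / ((β - 1) * (β - 2))
  set A := Z - 1 - p with hA
  have hA0 : 0 < A := by linarith
  have hZ0 : 0 < Z := by linarith
  have ha : (0:ℝ) ≤ a := Nat.cast_nonneg a
  have hb : (0:ℝ) ≤ b := Nat.cast_nonneg b
  -- From `h8`, `N - 1 - N T ≤ 2 a + 8 b ≤ 8 (a + b)`. The loss of `1/4` coming from the rounded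
  -- count of leaves is absorbed by `N / 4000`, which is where `N ≥ 1000` enters.
  have key : A * (N * (Z - 1)) ≤ 2 * (a + b) := by
    have : N * (A * (Z - 1) + 1 / 4000) ≤ N * ((1 - T) / 4) := by gcongr
    linarith
  have hY : A * ∑ v, y v ≤ A * a + 2 * (a + b) := by
    calc A * ∑ v, y v ≤ A * (a + N * (Z - 1)) := by gcongr; linarith
      _ ≤ _ := by linarith
  rw [show 2 - A / Z = (2 * Z - A) / Z by field_simp]
  -- This form also covers OPT = 0, where the quotient is 0 by convention.
  refine div_le_of_le_mul₀ (Nat.cast_nonneg _)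
    (div_nonneg (by linarith) hZ0.le) ?_
  rw [div_mul_eq_mul_div, le_div_iff₀ hZ0]
  have h2 : (2 * Z - A) * (∑ v, y v + a + b) ≤ (2 * Z - A) * (2 * (matchingGraph σ).opt) := by
    gcongr
    linarith
  -- The difference of the coefficients, `2 Z - A - (A + 2)`, equals `2 p`. Combined with `hY` this
  -- gives `2 Z y(V) ≤ (2 Z - A)(y(V) + a + b)`.
  have h3 : A * a + 2 * (a + b) ≤ (2 * Z - A) * (a + b) := by nlinarith
  linarith

theorem modelExpectation_le {α β c : ℝ} {f : PerfectMatching (Copies α β) → ℝ}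
    (h : ∀ σ, f σ ≤ c) : modelExpectation α β f ≤ c :=
  Finset.expect_le Finset.univ_nonempty fun σ _ => h σ

/-! ### Programming in the random access machine -/

namespace Expr

def var (a : ℕ) : Expr := cell a (const 0)

/-- The entry of array `a` whose index is the value of the variable `c`. -/
def entry (a c : ℕ) : Expr := cell a (var c)

/-- Truncated subtraction makes this 1 if the value of `e` is 0, and 0 otherwise; the remaining
connectives are built from it. -/
def not (e : Expr) : Expr := sub (const 1) e

def and (e f : Expr) : Expr := not (add (not e) (not f))

def eq (e f : Expr) : Expr := not (add (sub e f) (sub f e))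

/-- An expression holds if its value is nonzero. -/
def Holds (e : Expr) (m : Memory) : Prop := e.eval m ≠ 0

instance (e : Expr) (m : Memory) : Decidable (e.Holds m) := inferInstanceAs (Decidable (_ ≠ _))

variable {e f : Expr} {m : Memory}

@[simp] theorem eval_var (a : ℕ) : (var a).eval m = m a 0 := rfl

@[simp] theorem eval_entry (a c : ℕ) : (entry a c).eval m = m a (m c 0) := rfl

@[simp] theorem holds_not : (not e).Holds m ↔ ¬ e.Holds m := by
  simp only [Holds, not, eval]; omega

@[simp] theorem holds_and : (and e f).Holds m ↔ e.Holds m ∧ f.Holds m := by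
  simp only [Holds, and, not, eval]; omega

@[simp] theorem holds_add : (add e f).Holds m ↔ e.Holds m ∨ f.Holds m := by
  simp only [Holds, eval]; omega

@[simp] theorem holds_eq : (eq e f).Holds m ↔ e.eval m = f.eval m := by
  simp only [Holds, eq, not, eval]; omega

@[simp] theorem holds_sub : (sub e f).Holds m ↔ f.eval m < e.eval m := by
  simp only [Holds, eval]; omega

theorem holds_entry {a c : ℕ} : (entry a c).Holds m ↔ m a (m c 0) ≠ 0 := Iff.rfl

end Expr

namespace Program

theorem exec_branch (e : Expr) (p q : Program) (m : Memory) :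
    (branch e p q).exec m = if e.Holds m then p.exec m else q.exec m := rfl

/-- The arrays that a program writes to. -/
def writes : Program → List ℕ
  | skip => []
  | assign a _ _ => [a]
  | seq p q => p.writes ++ q.writes
  | branch _ p q => p.writes ++ q.writes
  | loop _ p => p.writes

/-- The frame rule behind all later statements that an array is unchanged. -/
theorem exec_of_not_mem_writes (p : Program) (m : Memory) {a : ℕ} (ha : a ∉ p.writes) :
    p.exec m a = m a := by
  induction p generalizing m with
  | skip => rfl
  | assign b i e =>
    simp only [writes, List.mem_singleton] at ha
    simp [exec, Function.update_of_ne ha]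
  | seq p q hp hq =>
    simp only [writes, List.mem_append, not_or] at ha
    simp only [exec]
    rw [hq _ ha.2, hp _ ha.1]
  | branch e p q hp hq =>
    simp only [writes, List.mem_append, not_or] at ha
    simp only [exec]
    split_ifs
    · exact hp _ ha.1
    · exact hq _ ha.2
  | loop e p hp =>
    simp only [exec]
    generalize e.eval m = k
    induction k with
    | zero => rfl
    | succ k ih => rw [Function.iterate_succ_apply', hp _ ha, ih]

/-- The programs whose loops run over the vertices or over the edges, up to one extra round. -/
def LoopBounded : Program → Prop
  | skip => True
  | assign a _ _ => 2 ≤ a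
  | seq p q => p.LoopBounded ∧ q.LoopBounded
  | branch _ p q => p.LoopBounded ∧ q.LoopBounded
  | loop e p => (e = .var 0 ∨ e = .var 1 ∨ e = .add (.var 0) (.const 1)) ∧ p.LoopBounded

theorem LoopBounded.exec_eq {p : Program} (hp : p.LoopBounded) (m : Memory) {a : ℕ} (ha : a < 2) :
    p.exec m a = m a := by
  refine exec_of_not_mem_writes p m fun h => ?_
  induction p with
  | skip => simp [writes] at h
  | assign b i e =>
    simp only [writes, List.mem_singleton] at h
    simp only [LoopBounded] at hp
    omega
  | seq p q ihp ihq | branch _ p q ihp ihq =>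
    rcases List.mem_append.1 h with h | h
    · exact ihp hp.1 h
    · exact ihq hp.2 h
  | loop e p ihp => exact ihp hp.2 h

/-- The input sizes in arrays 0 and 1 are never overwritten, so every round of a loop obeys the same
polynomial bound and nesting only multiplies polynomials. -/
theorem LoopBounded.exists_polynomial {p : Program} (hp : p.LoopBounded) :
    ∃ P : Polynomial ℕ, ∀ m : Memory, p.steps m ≤ P.eval (m 0 0 + m 1 0) := by
  induction p with
  | skip => exact ⟨1, fun m => by simp [steps]⟩
  | assign a i e => exact ⟨.C (i.cost + e.cost + 1), fun m => by simp [steps]⟩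
  | seq p q ihp ihq =>
    obtain ⟨P, hP⟩ := ihp hp.1
    obtain ⟨Q, hQ⟩ := ihq hp.2
    refine ⟨P + Q, fun m => ?_⟩
    rw [steps, Polynomial.eval_add]
    refine add_le_add (hP m) ((hQ _).trans_eq ?_)
    rw [hp.1.exec_eq m (by norm_num), hp.1.exec_eq m (by norm_num)]
  | branch e p q ihp ihq =>
    obtain ⟨P, hP⟩ := ihp hp.1
    obtain ⟨Q, hQ⟩ := ihq hp.2
    refine ⟨.C (e.cost + 1) + (P + Q), fun m => ?_⟩
    rw [steps, Polynomial.eval_add, Polynomial.eval_add, Polynomial.eval_C]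
    have := hP m
    have := hQ m
    split_ifs <;> omega
  | loop e p ihp =>
    obtain ⟨P, hP⟩ := ihp hp.2
    refine ⟨.C (e.cost + 1) + (.X + 1) * (P + 1), fun m => ?_⟩
    have hiter : ∀ j, ∀ a < 2, p.exec^[j] m a = m a := by
      intro j a ha
      induction j with
      | zero => rfl
      | succ j ih => rw [Function.iterate_succ_apply', hp.2.exec_eq _ ha, ih]
    have he : e.eval m ≤ m 0 0 + m 1 0 + 1 := by
      rcases hp.1 with rfl | rfl | rfl <;> simp [Expr.eval] <;> omega
    have hb : ∀ j ∈ Finset.range (e.eval m), p.steps (p.exec^[j] m) + 1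
        ≤ P.eval (m 0 0 + m 1 0) + 1 := fun j _ => by
      have := hP (p.exec^[j] m)
      rw [hiter j 0 (by norm_num), hiter j 1 (by norm_num)] at this
      omega
    have := Finset.sum_le_card_nsmul _ _ _ hb
    rw [Finset.card_range, smul_eq_mul] at this
    simp only [steps, Polynomial.eval_add, Polynomial.eval_mul, Polynomial.eval_C,
      Polynomial.eval_X, Polynomial.eval_one]
    gcongr
    exact this.trans (Nat.mul_le_mul_right _ he)

/-- The variable `c` runs through the numbers below the variable `b`. -/
def forLoop (b c : ℕ) (p : Program) : Program :=
  seq (assign c (.const 0) (.const 0))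
    (loop (.var b) (seq p (assign c (.const 0) (.add (.var c) (.const 1)))))

/-- An invariant rule for counted loops. The invariant must not depend on the counter array; in
return each round may use that the counter is `k` and that all arrays not written are as at the
start. -/
theorem exec_forLoop_induct {b c : ℕ} {p : Program} {m : Memory} (hbc : b ≠ c)
    (hc : c ∉ p.writes) (I : ℕ → Memory → Prop)
    (hI : ∀ k m' f, I k m' → I k (Function.update m' c f)) (h0 : I 0 m)
    (hs : ∀ k < m b 0, ∀ m', m' c 0 = k → (∀ a, a ≠ c → a ∉ p.writes → m' a = m a) →
      I k m' → I (k + 1) (p.exec m')) :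
    I (m b 0) ((forLoop b c p).exec m) := by
  set m₁ : Memory := Function.update m c (Function.update (m c) 0 0) with hm₁
  set q : Program := seq p (assign c (.const 0) (.add (.var c) (.const 1))) with hq
  have hb : m₁ b 0 = m b 0 := by rw [hm₁, Function.update_of_ne hbc]
  have hexec : (forLoop b c p).exec m = q.exec^[m b 0] m₁ := by
    rw [← hb]; rfl
  rw [hexec]
  have key : ∀ k ≤ m b 0, (q.exec^[k] m₁) c 0 = k ∧
      (∀ a, a ≠ c → a ∉ p.writes → (q.exec^[k] m₁) a = m a) ∧ I k (q.exec^[k] m₁) := by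
    intro k
    induction k with
    | zero =>
      intro _
      refine ⟨by simp [hm₁], fun a ha _ => by simp [hm₁, Function.update_of_ne ha], hI _ _ _ h0⟩
    | succ k ih =>
      intro hk
      obtain ⟨h1, h2, h3⟩ := ih (by omega)
      rw [Function.iterate_succ_apply']
      set m' := q.exec^[k] m₁
      have hpc : p.exec m' c = m' c := exec_of_not_mem_writes p m' hc
      refine ⟨?_, fun a ha ha' => ?_, hI _ _ _ (hs k (by omega) m' h1 h2 h3)⟩
      · simp [hq, exec, Expr.eval, hpc, h1]
      · simp only [hq, exec, Function.update_of_ne ha]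
        rw [exec_of_not_mem_writes p m' ha', h2 a ha ha']
  exact (key _ le_rfl).2.2

/-- Loops over the vertices simulate `List.foldl`. -/
theorem exec_forLoop_foldl {n c : ℕ} {p : Program} {m : Memory} (hn : m 0 0 = n) (h0c : 0 ≠ c)
    (hc : c ∉ p.writes) {S : Type} (R : S → Memory → Prop) (f : S → Fin n → S)
    (hR : ∀ s m' g, R s m' → R s (Function.update m' c g)) {s : S} (h0 : R s m)
    (hs : ∀ (i : Fin n) (s : S) (m' : Memory), m' c 0 = (i : ℕ) → R s m' → R (f s i) (p.exec m')) :
    R ((List.finRange n).foldl f s) ((forLoop 0 c p).exec m) := by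
  have := exec_forLoop_induct h0c hc (fun k m' => R (((List.finRange n).take k).foldl f s) m')
    (fun k m' g => hR _ m' g) h0 (fun k hk m' h1 _ h2 => by
      rw [hn] at hk
      rw [List.take_succ_eq_append_getElem (by simpa using hk), List.foldl_append]
      exact hs _ _ _ (by simpa using h1) h2)
  rw [hn, List.take_of_length_le (by simp)] at this
  exact this

end Program

/-! ### Reading the graph -/

open PowerLawVC.Program PowerLawVC.Expr

theorem adj_graphOfList {n : ℕ} (es : List (Fin n × Fin n)) (u v : Fin n) :
    (graphOfList es).Adj u v ↔ (u, v) ∈ es ∨ (v, u) ∈ es := by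
  simp only [Multigraph.Adj, graphOfList, Multiset.mem_coe, List.mem_map, Sym2.eq_iff, Prod.exists]
  grind

theorem deg_graphOfList_append {n : ℕ} (es : List (Fin n × Fin n)) (p : Fin n × Fin n)
    (v : Fin n) : (graphOfList (es ++ [p])).deg v
      = (graphOfList es).deg v + (if v = p.1 then 1 else 0) + (if v = p.2 then 1 else 0) := by
  have h : s(p.1, p.2).toMultiset = p.1 ::ₘ {p.2} := rfl
  simp only [Multigraph.deg, graphOfList, List.map_append, Multiset.map_coe, Multiset.sum_coe,
    List.sum_append, List.map_cons, List.map_nil, List.sum_cons, List.sum_nil, h,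
    Multiset.count_cons, Multiset.count_singleton]
  omega

/-- Arrays 5, 6, 7 hold the row offsets and the entries of the adjacency matrix, and the
degrees. -/
structure EncodesGraph {n : ℕ} (G : Multigraph (Fin n)) (size row mat deg : ℕ → ℕ) : Prop where
  size : size 0 = n
  row : ∀ u : Fin n, row u = u * n
  mat : ∀ u v : Fin n, mat (u * n + v) ≠ 0 ↔ G.Adj u v
  deg : ∀ u : Fin n, deg u = G.deg u

/-- The adjacency of the vertices that are the values of the variables `c` and `d`. -/
def Expr.adj (c d : ℕ) : Expr := cell 6 (add (entry 5 c) (var d))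

theorem Expr.holds_adj {n : ℕ} {G : Multigraph (Fin n)} {m : Memory}
    (h : EncodesGraph G (m 0) (m 5) (m 6) (m 7)) {c d : ℕ} {u v : Fin n} (hu : m c 0 = u)
    (hv : m d 0 = v) : (Expr.adj c d).Holds m ↔ G.Adj u v := by
  rw [← h.mat u v]
  simp only [Holds, Expr.adj, eval, eval_entry, eval_var, hu, hv, h.row]

/-- Without multiplication the offsets `u * n` are built by repeated addition. Each edge is entered
in the matrix in both directions and increases the degree entry at each end, so a loop counts twice.
-/
def readGraph : Program :=
  seq (forLoop 0 30 (assign 5 (add (var 30) (const 1)) (add (entry 5 30) (var 0))))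
    (forLoop 1 30
      (seq (assign 6 (add (cell 5 (entry 2 30)) (entry 3 30)) (const 1))
      (seq (assign 6 (add (cell 5 (entry 3 30)) (entry 2 30)) (const 1))
      (seq (assign 7 (entry 2 30) (add (cell 7 (entry 2 30)) (const 1)))
        (assign 7 (entry 3 30) (add (cell 7 (entry 3 30)) (const 1)))))))

theorem fin_mul_add_inj {n : ℕ} {u v a b : Fin n} :
    (u : ℕ) * n + v = a * n + b ↔ u = a ∧ v = b := by
  constructor
  · intro h
    have hn : 0 < n := u.pos
    have h1 := congrArg (· / n) h
    have h2 := congrArg (· % n) h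
    simp only [Nat.add_comm _ (v : ℕ), Nat.add_comm _ (b : ℕ), Nat.add_mul_div_right _ _ hn,
      Nat.add_mul_mod_self_right, Nat.div_eq_of_lt v.2, Nat.div_eq_of_lt b.2, zero_add,
      Nat.mod_eq_of_lt v.2, Nat.mod_eq_of_lt b.2] at h1 h2
    exact ⟨Fin.ext h1, Fin.ext h2⟩
  · rintro ⟨rfl, rfl⟩; rfl

theorem exec_readGraph {n : ℕ} (es : List (Fin n × Fin n)) {m : Memory}
    (hm : m = readGraph.exec (inputMemory es)) :
    EncodesGraph (graphOfList es) (m 0) (m 5) (m 6) (m 7) := by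
  set m₀ := inputMemory es with hm₀
  set p₁ := forLoop 0 30 (assign 5 (add (var 30) (const 1)) (add (entry 5 30) (var 0))) with hp₁
  set m₁ := p₁.exec m₀ with hm₁
  have hframe : ∀ a, a ≠ 30 → a ≠ 5 → m₁ a = m₀ a := fun a h1 h2 =>
    exec_of_not_mem_writes _ _ (by simp [hp₁, forLoop, writes, h1, h2])
  -- After `k` rounds the offsets up to and including `k` are correct; the last round also writes
  -- the offset of `n`.
  have hrow : ∀ u ≤ n, m₁ 5 u = u * n := by
    have := exec_forLoop_induct (b := 0) (c := 30) (m := m₀)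
      (p := assign 5 (add (var 30) (const 1)) (add (entry 5 30) (var 0)))
      (by norm_num) (by simp [writes]) (fun k m => ∀ u ≤ k, m 5 u = u * n) (fun _ _ _ h => h)
      (fun u hu => by rw [Nat.le_zero.1 hu]; simp [hm₀, inputMemory]) ?_
    · exact this
    · intro k hk m h1 h2 h3 u hu
      have h4 : m 0 0 = n := by rw [h2 0 (by norm_num) (by simp [writes])]; rfl
      simp only [exec, eval, eval_var, eval_entry, h1, h4, Function.update_self,
        Function.update_apply]
      split_ifs with h
      · rw [h3 k le_rfl, h]; ring
      · exact h3 u (by omega)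
  have hlen : m₁ 1 0 = es.length := by rw [hframe 1 (by norm_num) (by norm_num)]; rfl
  have main := exec_forLoop_induct (b := 1) (c := 30) (m := m₁)
      (p := (seq (assign 6 (add (cell 5 (entry 2 30)) (entry 3 30)) (const 1))
      (seq (assign 6 (add (cell 5 (entry 3 30)) (entry 2 30)) (const 1))
      (seq (assign 7 (entry 2 30) (add (cell 7 (entry 2 30)) (const 1)))
        (assign 7 (entry 3 30) (add (cell 7 (entry 3 30)) (const 1)))))))
      (by norm_num) (by simp [writes])
      (fun k m => (∀ u v : Fin n, m 6 (u * n + v) ≠ 0 ↔ (graphOfList (es.take k)).Adj u v) ∧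
        ∀ u : Fin n, m 7 u = (graphOfList (es.take k)).deg u) (fun _ _ _ h => h) ?_ ?_
  · rw [hlen, List.take_length] at main
    have hf : ∀ a, a ≠ 30 → a ≠ 6 → a ≠ 7 → m a = m₁ a := fun a h1 h2 h3 => by
      rw [hm]
      exact exec_of_not_mem_writes _ m₁ (by simp [forLoop, writes, h1, h2, h3])
    refine ⟨?_, fun u => ?_, ?_, ?_⟩
    · rw [hf 0 (by norm_num) (by norm_num) (by norm_num), hframe 0 (by norm_num) (by norm_num)]
      rfl
    · rw [hf 5 (by norm_num) (by norm_num) (by norm_num), hrow u u.2.le]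
    · rw [hm]; exact main.1
    · rw [hm]; exact main.2
  · rw [hframe 6 (by norm_num) (by norm_num), hframe 7 (by norm_num) (by norm_num)]
    simp [hm₀, inputMemory, graphOfList, Multigraph.Adj, Multigraph.deg]
  · intro k hk m' h1 h2 ⟨h3, h4⟩
    rw [hlen] at hk
    have e2 : m' 2 k = (es[k].1 : ℕ) := by
      rw [h2 2 (by norm_num) (by simp [writes]), hframe 2 (by norm_num) (by norm_num)]
      simp [hm₀, inputMemory, hk]
    have e3 : m' 3 k = (es[k].2 : ℕ) := by
      rw [h2 3 (by norm_num) (by simp [writes]), hframe 3 (by norm_num) (by norm_num)]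
      simp [hm₀, inputMemory, hk]
    have e5 : ∀ u : Fin n, m' 5 u = u * n := fun u => by
      rw [h2 5 (by norm_num) (by simp [writes]), hrow u u.2.le]
    rw [List.take_succ_eq_append_getElem hk]
    set a := es[k].1
    set b := es[k].2
    have hab : es[k] = (a, b) := rfl
    constructor
    · intro u v
      have h5 := h3 u v
      rw [adj_graphOfList] at h5 ⊢
      simp [exec, eval, Function.update_apply, h1, e2, e3, e5, fin_mul_add_inj, hab]
      grind
    · intro u
      have h5 := h4 u
      rw [deg_graphOfList_append]
      simp [exec, eval, Function.update_apply, h1, e2, e3, hab, Fin.val_inj]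
      grind

/-! ### Solving the linear program

Every vertex that has no mate bids for a neighbour of minimum price and takes it from its present
owner, which raises the price by 1. This computes a maximum matching of the bipartite double cover,
and a gap in the final prices yields a vertex cover of the double cover of the same size. The
arrays 8, 9, 10 hold the prices, the owners and the mates, where `n` stands for no vertex. -/

section Auction

variable {n : ℕ} {G : Multigraph (Fin n)}

/-- Approximate complementary slackness: a mate costs at most 1 more than any other neighbour. A
vertex once owned stays owned, so positive prices belong to owned vertices. Index `n` is a dummy of
price `n + 1` that caps the bids. -/
structure PriceInvariant (G : Multigraph (Fin n)) (price owner mate : ℕ → ℕ) : Prop where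
  mate_spec : ∀ u : Fin n, mate u ≠ n → ∃ v : Fin n, mate u = v ∧ G.Adj u v ∧ owner v = u ∧
    ∀ w : Fin n, G.Adj u w → price v ≤ price w + 1
  owner_spec : ∀ v : Fin n, owner v ≠ n → ∃ u : Fin n, owner v = u ∧ mate u = v
  owned : ∀ v : Fin n, price v ≠ 0 → owner v ≠ n
  price_le : ∀ v : Fin n, price v ≤ n + 1
  price_top : price n = n + 1

/-- No vertex without a mate can afford a neighbour. -/
def PriceStable (G : Multigraph (Fin n)) (price mate : ℕ → ℕ) : Prop :=
  ∀ u : Fin n, mate u = n → ∀ v : Fin n, G.Adj u v → n + 1 ≤ price v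

/-- The bidder takes a cheapest neighbour, so slackness holds after the increase by 1. For everyone
else the price of the mate is unchanged and other prices can only have risen. -/
theorem PriceInvariant.bid {price owner mate : ℕ → ℕ} (h : PriceInvariant G price owner mate)
    {u b : Fin n} (hu : mate u = n) (hub : G.Adj u b) (hb : price b < n + 1)
    (hmin : ∀ v : Fin n, G.Adj u v → price b ≤ price v) :
    PriceInvariant G (Function.update price b (price b + 1)) (Function.update owner b u)
      (Function.update (Function.update mate (owner b) n) u b) := by
  have hfin : ∀ v w : Fin n, (v : ℕ) = w ↔ v = w := fun v w => Fin.val_inj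
  have hne : ∀ v : Fin n, (v : ℕ) ≠ n := fun v => v.2.ne
  have hmono : ∀ v : Fin n, price v ≤ Function.update price b (price b + 1) v := fun v => by
    simp only [Function.update_apply, hfin]; split_ifs with hv
    · rw [hv]; omega
    · rfl
  refine ⟨fun u' => ?_, fun v => ?_, fun v => ?_, fun v => ?_, ?_⟩
  · intro hu'
    by_cases huu : u' = u
    · subst huu
      refine ⟨b, by simp, hub, by simp, fun w hw => ?_⟩
      have := hmin w hw
      have := hmono w
      simp only [Function.update_self]
      omega
    · simp only [Function.update_apply, hfin, huu, if_false] at hu' ⊢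
      by_cases ho : (u' : ℕ) = owner b
      · simp [ho] at hu'
      · simp only [ho, if_false] at hu' ⊢
        obtain ⟨v, h1, h2, h3, h4⟩ := h.mate_spec u' hu'
        have hvb : v ≠ b := by rintro rfl; exact ho h3.symm
        refine ⟨v, h1, h2, by simp [hvb, h3], fun w hw => ?_⟩
        have := h4 w hw
        have := hmono w
        simp only [Function.update_apply, hfin] at this
        simp only [hvb, if_false]
        omega
  · intro hv
    by_cases hvb : v = b
    · subst hvb
      exact ⟨u, by simp, by simp⟩
    · simp only [Function.update_apply, hfin, hvb, if_false] at hv ⊢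
      obtain ⟨u', h1, h2⟩ := h.owner_spec v hv
      refine ⟨u', h1, ?_⟩
      have h3 : u' ≠ u := by rintro rfl; exact hne v (h2.symm.trans hu)
      -- The displaced owner had mate `b`, whereas the mate of `u'` is `v ≠ b`.
      have h4 : (u' : ℕ) ≠ owner b := by
        intro h4
        obtain ⟨w, h5, h6⟩ := h.owner_spec b (by rw [← h4]; exact hne u')
        have : u' = w := Fin.ext (h4.trans h5)
        subst this
        exact hvb (Fin.ext (h2.symm.trans h6))
      simp [h3, h4, h2]
  · simp only [Function.update_apply, hfin]
    split_ifs with hv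
    · exact fun _ => hne u
    · exact h.owned v
  · simp only [Function.update_apply, hfin]
    split_ifs with hv
    · omega
    · exact h.price_le v
  · rw [Function.update_of_ne (hne b).symm]
    exact h.price_top

theorem sum_price_lt {price : ℕ → ℕ} (b : Fin n) :
    ∑ v : Fin n, price v < ∑ v : Fin n, Function.update price b (price b + 1) v := by
  refine Finset.sum_lt_sum (fun v _ => ?_) ⟨b, Finset.mem_univ _, by simp⟩
  simp only [Function.update_apply]
  split_ifs with h
  · rw [h]; omega
  · rfl

/-- The variable 11 receives a neighbour of minimum price of the vertex 30. -/
def cheapest : Program :=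
  seq (assign 11 (const 0) (var 0))
    (forLoop 0 31 (branch (and (Expr.adj 30 31) (sub (entry 8 11) (entry 8 31)))
      (assign 11 (const 0) (var 31)) skip))

/-- If the chosen vertex has no owner, its owner entry is `n`, and resetting the mate of the former
owner writes to entry `n`, which belongs to no vertex. -/
def bid : Program :=
  branch (eq (entry 10 30) (var 0))
    (seq cheapest
      (branch (sub (var 0) (var 11))
        (seq (assign 10 (entry 9 11) (var 0))
        (seq (assign 9 (var 11) (var 30))
        (seq (assign 10 (var 30) (var 11))
          (assign 8 (var 11) (add (entry 8 11) (const 1))))))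
        skip))
    skip

/-- The search starts from the dummy `n` and moves only to strictly cheaper vertices, so the answer
`n` means that no neighbour is affordable. -/
theorem exec_cheapest {m : Memory} (hG : EncodesGraph G (m 0) (m 5) (m 6) (m 7)) {u : Fin n}
    (hu : m 30 0 = u) {m' : Memory} (hm' : m' = cheapest.exec m) :
    (m' 11 0 = n ∨ ∃ b : Fin n, m' 11 0 = b ∧ G.Adj u b ∧ m 8 b < m 8 n) ∧
      ∀ v : Fin n, G.Adj u v → m 8 (m' 11 0) ≤ m 8 v ∨ m 8 n ≤ m 8 v := by
  set m₁ := (assign 11 (const 0) (var 0)).exec m with hm₁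
  have hm₁' : ∀ a, a ≠ 11 → m₁ a = m a := fun a ha =>
    exec_of_not_mem_writes _ _ (by simp [writes, ha])
  have hn : m₁ 0 0 = n := by rw [hm₁' 0 (by norm_num)]; exact hG.size
  have h11 : m₁ 11 0 = n := by simp [hm₁, exec, eval, hG.size]
  have := exec_forLoop_induct (b := 0) (c := 31) (m := m₁)
    (p := branch (and (Expr.adj 30 31) (sub (entry 8 11) (entry 8 31)))
      (assign 11 (const 0) (var 31)) skip) (by norm_num) (by simp [writes])
    (fun k m' => (m' 11 0 = n ∨ ∃ b : Fin n, m' 11 0 = b ∧ G.Adj u b ∧ m 8 b < m 8 n) ∧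
      (m 8 (m' 11 0) ≤ m 8 n) ∧
      ∀ v : Fin n, (v : ℕ) < k → G.Adj u v → m 8 (m' 11 0) ≤ m 8 v) (fun _ _ _ h => h)
    ⟨.inl h11, by rw [h11], by simp⟩ ?_
  · rw [hn] at this
    have hm'' : m' = (forLoop 0 31 (branch (and (Expr.adj 30 31) (sub (entry 8 11) (entry 8 31)))
      (assign 11 (const 0) (var 31)) skip)).exec m₁ := hm'
    rw [← hm''] at this
    exact ⟨this.1, fun v hv => .inl (this.2.2 v v.2 hv)⟩
  · intro k hk m₂ h1 h2 ⟨h3, h3', h4⟩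
    rw [hn] at hk
    have hfr : ∀ a, a ≠ 11 → a ≠ 31 → m₂ a = m a := fun a ha ha' => by
      rw [h2 a ha' (by simp [writes, ha]), hm₁' a ha]
    have hG' : EncodesGraph G (m₂ 0) (m₂ 5) (m₂ 6) (m₂ 7) := by
      rw [hfr 0, hfr 5, hfr 6, hfr 7] <;> first | exact hG | norm_num
    have hadj : (Expr.adj 30 31).Holds m₂ ↔ G.Adj u ⟨k, hk⟩ :=
      holds_adj hG' (by rw [hfr 30 (by norm_num) (by norm_num), hu]) h1
    have h8 : m₂ 8 = m 8 := hfr 8 (by norm_num) (by norm_num)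
    rw [exec_branch]
    have hiff : (and (Expr.adj 30 31) (sub (entry 8 11) (entry 8 31))).Holds m₂ ↔
        G.Adj u ⟨k, hk⟩ ∧ m 8 k < m 8 (m₂ 11 0) := by
      rw [holds_and, hadj, holds_sub, eval_entry, eval_entry, h8, h1]
    split_ifs with hc <;> rw [hiff] at hc
    · have e : (assign 11 (const 0) (var 31)).exec m₂ 11 0 = k := by simp [exec, eval, h1]
      rw [e]
      refine ⟨.inr ⟨⟨k, hk⟩, rfl, hc.1, hc.2.trans_le h3'⟩, (hc.2.trans_le h3').le,
        fun v hv hvu => ?_⟩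
      by_cases hvk : (v : ℕ) = k
      · rw [hvk]
      · exact hc.2.le.trans (h4 v (by omega) hvu)
    · refine ⟨h3, h3', fun v hv hvu => ?_⟩
      by_cases hvk : (v : ℕ) = k
      · have : v = ⟨k, hk⟩ := Fin.ext hvk
        subst this
        simp only [hvu, true_and, not_lt] at hc
        exact hc
      · exact h4 v (by omega) hvu

theorem exec_bid {m : Memory} (hG : EncodesGraph G (m 0) (m 5) (m 6) (m 7))
    (htop : m 8 n = n + 1) {u : Fin n} (hu : m 30 0 = u) {m' : Memory} (hm' : m' = bid.exec m) :
    (m' 8 = m 8 ∧ m' 9 = m 9 ∧ m' 10 = m 10 ∧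
        (m 10 u = n → ∀ v : Fin n, G.Adj u v → n + 1 ≤ m 8 v)) ∨
      m 10 u = n ∧ ∃ b : Fin n, G.Adj u b ∧ m 8 b < n + 1 ∧
        (∀ v : Fin n, G.Adj u v → m 8 b ≤ m 8 v) ∧
        m' 8 = Function.update (m 8) b (m 8 b + 1) ∧ m' 9 = Function.update (m 9) b u ∧
        m' 10 = Function.update (Function.update (m 10) (m 9 b) n) u b := by
  rw [bid, exec_branch] at hm'
  simp only [holds_eq, eval_entry, eval_var, hu, hG.size] at hm'
  split_ifs at hm' with hc
  swap
  · subst hm'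
    exact .inl ⟨rfl, rfl, rfl, fun h => absurd h hc⟩
  rw [exec] at hm'
  set m₁ := cheapest.exec m with hm₁
  have hfr : ∀ a, a ≠ 11 → a ≠ 31 → m₁ a = m a := fun a ha ha' =>
    exec_of_not_mem_writes _ _ (by simp [cheapest, forLoop, writes, ha, ha'])
  have hn : m₁ 0 0 = n := by rw [hfr 0 (by norm_num) (by norm_num)]; exact hG.size
  obtain ⟨h1, h2⟩ := exec_cheapest hG hu hm₁
  rw [htop] at h2
  rw [exec_branch] at hm'
  simp only [holds_sub, eval_var, hn] at hm'
  rcases h1 with h1 | ⟨b, hb, hub, hlt⟩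
  · rw [h1, if_neg (lt_irrefl _)] at hm'
    rw [hm', exec, hfr 8 (by norm_num) (by norm_num), hfr 9 (by norm_num) (by norm_num),
      hfr 10 (by norm_num) (by norm_num)]
    refine .inl ⟨rfl, rfl, rfl, fun _ v hv => ?_⟩
    rcases h2 v hv with h | h
    · rwa [h1, htop] at h
    · exact h
  · rw [hb, if_pos b.2] at hm'
    rw [htop] at hlt
    refine .inr ⟨hc, b, hub, hlt, fun v hv => ?_, ?_, ?_, ?_⟩
    · have := h2 v hv
      rw [hb] at this
      omega
    all_goals
      rw [hm']
      simp [exec, eval, hb, hn, hfr 8, hfr 9, hfr 10, hfr 30, hu]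

/-- Either some bid raises the total price, or nothing changes and all vertices have been tested
against the same prices, which is stability. A stable state admits no bid. -/
theorem exec_bidRound {m : Memory} (hG : EncodesGraph G (m 0) (m 5) (m 6) (m 7))
    (hI : PriceInvariant G (m 8) (m 9) (m 10)) {m' : Memory}
    (hm' : m' = (forLoop 0 30 bid).exec m) :
    EncodesGraph G (m' 0) (m' 5) (m' 6) (m' 7) ∧ PriceInvariant G (m' 8) (m' 9) (m' 10) ∧
      (PriceStable G (m' 8) (m' 10) ∨ ∑ v : Fin n, m 8 v < ∑ v : Fin n, m' 8 v) ∧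
      (PriceStable G (m 8) (m 10) → PriceStable G (m' 8) (m' 10)) := by
  have hw : bid.writes = [11, 31, 11, 31, 10, 9, 10, 8] := rfl
  have := exec_forLoop_induct (b := 0) (c := 30) (m := m) (p := bid) (by norm_num)
    (by simp [hw])
    (fun k m' => PriceInvariant G (m' 8) (m' 9) (m' 10) ∧
      (¬ PriceStable G (m 8) (m 10) ∧ ∑ v : Fin n, m 8 v < ∑ v : Fin n, m' 8 v ∨
        m' 8 = m 8 ∧ m' 9 = m 9 ∧ m' 10 = m 10 ∧ ∀ u : Fin n, (u : ℕ) < k → m 10 u = n →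
          ∀ v : Fin n, G.Adj u v → n + 1 ≤ m 8 v)) (fun _ _ _ h => h)
    ⟨hI, .inr ⟨rfl, rfl, rfl, by simp⟩⟩ ?_
  · rw [← hm', hG.size] at this
    have hfr : ∀ a, a < 8 → m' a = m a := fun a ha => by
      rw [hm']
      refine exec_of_not_mem_writes _ _ ?_
      simp [forLoop, writes, hw]
      omega
    refine ⟨?_, this.1, ?_, ?_⟩
    · rw [hfr 0, hfr 5, hfr 6, hfr 7] <;> first | exact hG | norm_num
    · rcases this.2 with h | ⟨h1, h2, h3, h4⟩
      · exact .inr h.2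
      · rw [h1, h3]
        exact .inl fun u hu => h4 u u.2 hu
    · intro hs
      rcases this.2 with h | ⟨h1, h2, h3, h4⟩
      · exact absurd hs h.1
      · rwa [h1, h3]
  · intro k hk m₁ h1 h2 ⟨h3, h4⟩
    rw [hG.size] at hk
    have hG' : EncodesGraph G (m₁ 0) (m₁ 5) (m₁ 6) (m₁ 7) := by
      rw [h2 0, h2 5, h2 6, h2 7] <;> first | exact hG | simp [hw]
    rcases exec_bid hG' h3.price_top (u := ⟨k, hk⟩) h1 rfl with
      ⟨e8, e9, e10, h⟩ | ⟨hu, b, hub, hlt, hmin, e8, e9, e10⟩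
    · rw [e8, e9, e10]
      refine ⟨h3, h4.imp_right fun ⟨h5, h6, h7, h8⟩ => ⟨h5, h6, h7, fun u hu => ?_⟩⟩
      by_cases huk : (u : ℕ) = k
      · have : u = ⟨k, hk⟩ := Fin.ext huk
        subst this
        rwa [h5, h7] at h
      · exact h8 u (by omega)
    · rw [e8, e9, e10]
      refine ⟨h3.bid hu hub hlt hmin, .inl ?_⟩
      rcases h4 with h4 | ⟨h5, h6, h7, h8⟩
      · exact ⟨h4.1, h4.2.trans (sum_price_lt b)⟩
      · rw [h7] at hu
        rw [h5] at hlt ⊢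
        refine ⟨fun hs => ?_, sum_price_lt b⟩
        have := hs _ hu b hub
        omega

/-- The nested loops produce `(n + 1)²` rounds without multiplication. -/
def auction : Program :=
  seq (forLoop 0 30 (seq (assign 9 (var 30) (var 0)) (assign 10 (var 30) (var 0))))
  (seq (assign 8 (var 0) (add (var 0) (const 1)))
    (loop (add (var 0) (const 1)) (loop (add (var 0) (const 1)) (forLoop 0 30 bid))))

theorem exec_auction {m : Memory} (hG : EncodesGraph G (m 0) (m 5) (m 6) (m 7))
    (h8 : ∀ i, m 8 i = 0) {m' : Memory} (hm' : m' = auction.exec m) :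
    EncodesGraph G (m' 0) (m' 5) (m' 6) (m' 7) ∧ PriceInvariant G (m' 8) (m' 9) (m' 10) ∧
      PriceStable G (m' 8) (m' 10) := by
  set p := seq (assign 9 (var 30) (var 0)) (assign 10 (var 30) (var 0)) with hp
  set m₁ := (forLoop 0 30 p).exec m with hm₁
  have hfr : ∀ a, a < 9 → m₁ a = m a := fun a ha =>
    exec_of_not_mem_writes _ _ (by simp [forLoop, writes, hp]; omega)
  have hn₁ : m₁ 0 0 = n := by rw [hfr 0 (by norm_num)]; exact hG.size
  have hinit : ∀ u : Fin n, m₁ 9 u = n ∧ m₁ 10 u = n := by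
    have := exec_forLoop_induct (b := 0) (c := 30) (m := m) (p := p) (by norm_num)
      (by simp [writes, hp])
      (fun k m' => ∀ u < k, m' 9 u = n ∧ m' 10 u = n) (fun _ _ _ h => h) (by simp) ?_
    · rw [hG.size] at this
      exact fun u => this u u.2
    · intro k hk m₂ h1 h2 h3 u hu
      have h4 : m₂ 0 0 = n := by rw [h2 0 (by norm_num) (by simp [writes, hp])]; exact hG.size
      have h5 := h3 u
      simp [hp, exec, h1, h4, Function.update_apply]
      grind
  set m₂ := (assign 8 (var 0) (add (var 0) (const 1))).exec m₁ with hm₂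
  have h28 : m₂ 8 = Function.update (m 8) n (n + 1) := by
    simp [hm₂, exec, eval, hn₁, hfr 8]
  have hfr₂ : ∀ a, a ≠ 8 → m₂ a = m₁ a := fun a ha =>
    exec_of_not_mem_writes _ _ (by simp [writes, ha])
  have hn₂ : m₂ 0 0 = n := by rw [hfr₂ 0 (by norm_num), hn₁]
  have hexec : m' = (forLoop 0 30 bid).exec^[(n + 1) * (n + 1)] m₂ := by
    have hw : bid.writes = [11, 31, 11, 31, 10, 9, 10, 8] := rfl
    have hin : ∀ x : Memory, x 0 0 = n → (loop (add (var 0) (const 1)) (forLoop 0 30 bid)).exec x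
        = (forLoop 0 30 bid).exec^[n + 1] x := fun x hx => by
      simp [exec, eval, hx]
    have hout : ∀ k, ((loop (add (var 0) (const 1)) (forLoop 0 30 bid)).exec^[k] m₂) 0 0 = n ∧
        (loop (add (var 0) (const 1)) (forLoop 0 30 bid)).exec^[k] m₂
          = (forLoop 0 30 bid).exec^[(n + 1) * k] m₂ := by
      intro k
      induction k with
      | zero => exact ⟨hn₂, rfl⟩
      | succ k ih =>
        rw [Function.iterate_succ_apply']
        constructor
        · rw [exec_of_not_mem_writes _ _ (by simp [forLoop, writes, hw])]
          exact ih.1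
        · rw [hin _ ih.1, ih.2, ← Function.iterate_add_apply]
          congr 1
          ring
    rw [hm', auction, exec, exec]
    change (loop (add (var 0) (const 1)) (loop (add (var 0) (const 1)) (forLoop 0 30 bid))).exec m₂
      = _
    rw [exec]
    have : (add (var 0) (const 1)).eval m₂ = n + 1 := by simp [eval, hn₂]
    rw [this]
    exact (hout _).2
  have hne : ∀ v : Fin n, (v : ℕ) ≠ n := fun v => v.2.ne
  have key : ∀ k, ∀ x, x = (forLoop 0 30 bid).exec^[k] m₂ →
      EncodesGraph G (x 0) (x 5) (x 6) (x 7) ∧ PriceInvariant G (x 8) (x 9) (x 10) ∧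
        (PriceStable G (x 8) (x 10) ∨ k ≤ ∑ v : Fin n, x 8 v) := by
    intro k
    induction k with
    | zero =>
      rintro x rfl
      refine ⟨?_, ?_, .inr (Nat.zero_le _)⟩
      · rw [Function.iterate_zero, id, hfr₂ 0, hfr₂ 5, hfr₂ 6, hfr₂ 7, hfr 0, hfr 5, hfr 6, hfr 7]
          <;> first | exact hG | norm_num
      · rw [Function.iterate_zero, id, h28, hfr₂ 9 (by norm_num), hfr₂ 10 (by norm_num)]
        refine ⟨fun u hu => absurd (hinit u).2 hu, fun u hu => absurd (hinit u).1 hu,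
          fun v hv => ?_, fun v => ?_, by simp⟩
        · simp [hne, h8] at hv
        · simp [hne, h8]
    | succ k ih =>
      intro x hx
      rw [Function.iterate_succ_apply'] at hx
      obtain ⟨h1, h2, h3⟩ := ih _ rfl
      obtain ⟨h4, h5, h6, h7⟩ := exec_bidRound h1 h2 hx
      refine ⟨h4, h5, ?_⟩
      rcases h3 with h3 | h3
      · exact .inl (h7 h3)
      · exact h6.imp_right fun h => by omega
  obtain ⟨h1, h2, h3⟩ := key _ m' hexec
  refine ⟨h1, h2, h3.resolve_right fun h => ?_⟩
  -- The total price never exceeds `n (n + 1)`, so `(n + 1)²` price-raising rounds are impossible.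
  have h4 : ∑ v : Fin n, m' 8 v ≤ ∑ _v : Fin n, (n + 1) := Finset.sum_le_sum fun v _ => h2.price_le v
  simp at h4
  nlinarith

/-! ### The optimal half-integral solution -/

/-- A vertex cover `A`, `B` of the bipartite double cover and a matching of its vertices to each
other or to vertices outside certify an optimal half-integral solution. -/
theorem isOptimalHalfIntegral_of_matching {V : Type} [Fintype V] [DecidableEq V]
    {G : Multigraph V} (A B : Finset V) (f g : V → V) (hf : Set.InjOn f A) (hg : Set.InjOn g B)
    (hA : ∀ u ∈ A, G.Adj u (f u) ∧ f u ∉ B) (hB : ∀ v ∈ B, G.Adj (g v) v ∧ g v ∉ A)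
    (hcov : ∀ u v, G.Adj u v → u ∈ A ∨ v ∈ B) :
    G.IsOptimalHalfIntegral fun v => ((if v ∈ A then 1 else 0) + (if v ∈ B then 1 else 0)) / 2 := by
  refine ⟨fun v => ?_, ⟨fun v => ?_, fun u v huv => ?_⟩, fun z hz => ?_⟩
  · dsimp only; split_ifs <;> norm_num
  · positivity
  · have h1 := hcov u v huv
    have h2 := hcov v u huv.symm
    dsimp only
    split_ifs <;> first | tauto | norm_num
  · have h1 : ∑ v, (((if v ∈ A then 1 else 0) + (if v ∈ B then 1 else 0)) / 2 : ℝ)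
        = ((#A : ℝ) + #B) / 2 := by
      rw [← Finset.sum_div, Finset.sum_add_distrib]
      simp
    have h2 : (#A : ℝ) ≤ ∑ u ∈ A, (z u + z (f u)) := by
      rw [Finset.cast_card]
      exact Finset.sum_le_sum fun u hu => hz.2 _ _ (hA u hu).1
    have h3 : (#B : ℝ) ≤ ∑ v ∈ B, (z (g v) + z v) := by
      rw [Finset.cast_card]
      exact Finset.sum_le_sum fun u hu => hz.2 _ _ (hB u hu).1
    -- LP duality in the double cover: `h4` collects the left ends of the matching edges and `h5`
    -- the right ends. Each is a set of distinct vertices, so two copies of `z(V)` bound `#A + #B`.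
    have h4 : ∑ u ∈ A, z u + ∑ v ∈ B, z (g v) ≤ ∑ v, z v := by
      rw [← Finset.sum_image (f := z) hg, ← Finset.sum_union]
      · exact Finset.sum_le_sum_of_subset_of_nonneg (Finset.subset_univ _) fun v _ _ => hz.1 v
      · rw [Finset.disjoint_left]
        intro u hu hu'
        obtain ⟨v, hv, rfl⟩ := Finset.mem_image.1 hu'
        exact (hB v hv).2 hu
    have h5 : ∑ u ∈ A, z (f u) + ∑ v ∈ B, z v ≤ ∑ v, z v := by
      rw [← Finset.sum_image (f := z) hf, ← Finset.sum_union]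
      · exact Finset.sum_le_sum_of_subset_of_nonneg (Finset.subset_univ _) fun v _ _ => hz.1 v
      · rw [Finset.disjoint_left]
        intro u hu hu'
        obtain ⟨v, hv, rfl⟩ := Finset.mem_image.1 hu
        exact (hA v hv).2 hu'
    rw [Finset.sum_add_distrib] at h2 h3
    rw [h1]
    linarith

-- Take the left vertices with a neighbour of price below `j` and the right vertices of price above
-- `j`. Since no price equals `j`, every edge of the double cover is covered. By stability each
-- chosen left vertex has a mate, and each chosen right vertex has an owner. Slackness and the gap
-- keep a mate of a chosen left vertex below `j`, so no matching edge has both ends chosen.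
open Classical in
theorem PriceInvariant.isOptimalHalfIntegral {price owner mate : ℕ → ℕ}
    (h : PriceInvariant G price owner mate) (hs : PriceStable G price mate) {j : ℕ} (hj : j ≤ n + 1)
    (hgap : ∀ v : Fin n, price v ≠ j) :
    G.IsOptimalHalfIntegral fun v => ((if ∃ w, G.Adj v w ∧ price w < j then 1 else 0)
      + (if j < price v then 1 else 0)) / 2 := by
  set A : Finset (Fin n) := {v | ∃ w, G.Adj v w ∧ price w < j} with hA
  set B : Finset (Fin n) := {v | j < price v} with hB
  have hmate : ∀ u ∈ A, ∃ v : Fin n, mate u = v ∧ G.Adj u v ∧ owner v = u ∧ price v < j := by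
    intro u hu
    obtain ⟨w, huw, hw⟩ := (Finset.mem_filter.1 hu).2
    obtain ⟨v, h1, h2, h3, h4⟩ := h.mate_spec u fun hu => by
      have := hs u hu w huw
      omega
    -- Slackness gives `price v ≤ price w + 1 ≤ j`, and the gap excludes equality.
    exact ⟨v, h1, h2, h3, by have := h4 w huw; have := hgap v; omega⟩
  have howner : ∀ v ∈ B, ∃ u : Fin n, owner v = u ∧ mate u = v := fun v hv =>
    h.owner_spec v (h.owned v (by have := (Finset.mem_filter.1 hv).2; omega))
  have hown : ∀ v : Fin n, ∀ u : Fin n, mate u = v → mate u ≠ n := fun v u h => by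
    rw [h]; exact v.2.ne
  have h1 : ∀ u : Fin n, ∃ v : Fin n, u ∈ A → mate u = v ∧ G.Adj u v ∧ owner v = u ∧ price v < j :=
    fun u => by
      by_cases hu : u ∈ A
      · obtain ⟨v, hv⟩ := hmate u hu; exact ⟨v, fun _ => hv⟩
      · exact ⟨u, fun h => absurd h hu⟩
  have h2 : ∀ v : Fin n, ∃ u : Fin n, v ∈ B → owner v = u ∧ mate u = v :=
    fun v => by
      by_cases hv : v ∈ B
      · obtain ⟨u, hu⟩ := howner v hv; exact ⟨u, fun _ => hu⟩
      · exact ⟨v, fun h => absurd h hv⟩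
  choose f hf using h1
  choose g hg using h2
  have := isOptimalHalfIntegral_of_matching (G := G) A B f g
    (fun u hu u' hu' he => by
      have e1 := (hf u hu).2.2.1
      have e2 := (hf u' hu').2.2.1
      rw [he] at e1
      exact Fin.ext (e1.symm.trans e2))
    (fun v hv v' hv' he => by
      have e1 := (hg v hv).2
      have e2 := (hg v' hv').2
      rw [he] at e1
      exact Fin.ext (e1.symm.trans e2))
    (fun u hu => ⟨(hf u hu).2.1, by
      have := (hf u hu).2.2.2
      simp [hB]
      omega⟩)
    (fun v hv => by
      obtain ⟨v', e1, e2, -⟩ := h.mate_spec (g v) (hown v _ (hg v hv).2)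
      have e3 : v' = v := Fin.ext (e1.symm.trans (hg v hv).2)
      subst e3
      refine ⟨e2, fun hA => ?_⟩
      obtain ⟨e4, -, -, e5⟩ := hf _ hA
      have e6 : f (g v') = v' := Fin.ext (e4.symm.trans e1)
      rw [e6] at e5
      have := (Finset.mem_filter.1 hv).2
      omega)
    (fun u v huv => by
      by_cases hv : price v < j
      · exact .inl (by simp only [hA, Finset.mem_filter, Finset.mem_univ, true_and]; exact ⟨v, huv, hv⟩)
      · have := hgap v
        exact .inr (by simp only [hB, Finset.mem_filter, Finset.mem_univ, true_and]; omega))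
  simpa [hA, hB] using this

end Auction

section Solution

variable {n : ℕ} {G : Multigraph (Fin n)}

/-- The variable 14 receives a positive number that is not the price of a vertex. -/
def findGap : Program :=
  seq (forLoop 0 30 (assign 13 (entry 8 30) (const 1)))
  (seq (assign 11 (const 0) (const 0))
  (loop (add (var 0) (const 1))
    (seq (assign 11 (const 0) (add (var 11) (const 1)))
      (branch (entry 13 11) skip (assign 14 (const 0) (var 11))))))

/-- The `n` prices cannot occupy all of `1, …, n + 1`, so some number is unmarked; the last unmarked
one is kept. -/
theorem exec_findGap {m : Memory} (hn : m 0 0 = n) (h13 : ∀ i, m 13 i = 0) (h14 : m 14 0 = 0)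
    {m' : Memory} (hm' : m' = findGap.exec m) :
    m' 14 0 ≤ n + 1 ∧ ∀ v : Fin n, m 8 v ≠ m' 14 0 := by
  set m₁ := (forLoop 0 30 (assign 13 (entry 8 30) (const 1))).exec m with hm₁
  have hfr : ∀ a, a ≠ 13 → a ≠ 30 → m₁ a = m a := fun a h h' =>
    exec_of_not_mem_writes _ _ (by simp [forLoop, writes, h, h'])
  have hhas : ∀ i, m₁ 13 i ≠ 0 ↔ ∃ v : Fin n, m 8 v = i := by
    have := exec_forLoop_induct (b := 0) (c := 30) (m := m)
      (p := assign 13 (entry 8 30) (const 1)) (by norm_num) (by simp [writes])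
      (fun k m' => ∀ i, m' 13 i ≠ 0 ↔ ∃ v : Fin n, (v : ℕ) < k ∧ m 8 v = i) (fun _ _ _ h => h)
      (by simp [h13]) ?_
    · rw [hn] at this
      intro i
      rw [this i]
      exact ⟨fun ⟨v, _, h⟩ => ⟨v, h⟩, fun ⟨v, h⟩ => ⟨v, v.2, h⟩⟩
    · intro k hk x h1 h2 h3 i
      rw [hn] at hk
      have h8 : x 8 = m 8 := h2 8 (by norm_num) (by simp [writes])
      have h4 := h3 i
      simp only [exec, eval_entry, eval, h8, h1, Function.update_self, Function.update_apply]
      split_ifs with h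
      · simp only [ne_eq, one_ne_zero, not_false_iff, true_iff]
        exact ⟨⟨k, hk⟩, by simp, h.symm⟩
      · rw [h4]
        constructor
        · rintro ⟨v, hv, hvi⟩; exact ⟨v, by omega, hvi⟩
        · rintro ⟨v, hv, hvi⟩
          refine ⟨v, ?_, hvi⟩
          by_contra hvk
          have : (v : ℕ) = k := by omega
          rw [this] at hvi
          exact h hvi.symm
  set m₂ := (assign 11 (const 0) (const 0)).exec m₁ with hm₂
  set q := seq (assign 11 (const 0) (add (var 11) (const 1)))
      (branch (entry 13 11) skip (assign 14 (const 0) (var 11))) with hq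
  have hexec : m' = q.exec^[n + 1] m₂ := by
    have : (add (var 0) (const 1)).eval m₂ = n + 1 := by
      have : m₂ 0 0 = m₁ 0 0 := rfl
      simp [eval, this, hfr 0, hn]
    rw [← this, hm']
    rfl
  -- The initial value 0 in variable 14 may itself be a price, so correctness is only asserted after
  -- an unmarked number has been passed.
  have key : ∀ k, (q.exec^[k] m₂) 11 0 = k ∧ (q.exec^[k] m₂) 13 = m₁ 13 ∧
      (q.exec^[k] m₂) 14 0 ≤ k ∧ ((∃ i, 1 ≤ i ∧ i ≤ k ∧ m₁ 13 i = 0) →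
        m₁ 13 ((q.exec^[k] m₂) 14 0) = 0) := by
    intro k
    induction k with
    | zero =>
      refine ⟨by simp [hm₂, exec, eval], rfl, ?_, ?_⟩
      · have : m₂ 14 0 = m₁ 14 0 := rfl
        simp [this, hfr 14, h14]
      · rintro ⟨i, h1, h2, -⟩; omega
    | succ k ih =>
      rw [Function.iterate_succ_apply']
      set x := q.exec^[k] m₂
      obtain ⟨h1, h2, h3, h4⟩ := ih
      set x' := (assign 11 (const 0) (add (var 11) (const 1))).exec x with hx'
      have e11 : x' 11 0 = k + 1 := by simp [hx', exec, eval, h1]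
      have e13 : x' 13 = m₁ 13 := h2
      have e14 : x' 14 = x 14 := rfl
      have hx : q.exec x = if (entry 13 11).Holds x' then x'
          else (assign 14 (const 0) (var 11)).exec x' := rfl
      rw [hx]
      by_cases hc : (entry 13 11).Holds x'
      · rw [if_pos hc]
        refine ⟨e11, e13, by rw [e14]; omega, fun ⟨i, hi, hi', hi0⟩ => ?_⟩
        rw [e14]
        refine h4 ⟨i, hi, ?_, hi0⟩
        rw [holds_entry, e11, e13] at hc
        rcases Nat.lt_or_ge k i with h | h
        · exact absurd hi0 (by rwa [show i = k + 1 by omega])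
        · exact h
      · rw [if_neg hc]
        have e : (assign 14 (const 0) (var 11)).exec x' 14 0 = k + 1 := by
          simp [exec, eval, e11]
        refine ⟨e11, e13, e.le, fun _ => ?_⟩
        rw [e]
        rw [holds_entry, e11, e13, not_not] at hc
        exact hc
  obtain ⟨-, -, h3, h4⟩ := key (n + 1)
  rw [← hexec] at h3 h4
  refine ⟨h3, fun v hv => (hhas _).2 ⟨v, hv⟩ (h4 ?_)⟩
  by_contra! hall
  have : Finset.Icc 1 (n + 1) ⊆ Finset.univ.image fun v : Fin n => m 8 v := by
    intro i hi
    rw [Finset.mem_Icc] at hi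
    obtain ⟨w, hw⟩ := (hhas i).1 (hall i hi.1 hi.2)
    exact Finset.mem_image.2 ⟨w, Finset.mem_univ _, hw⟩
  have := (Finset.card_le_card this).trans Finset.card_image_le
  simp at this

/-- The arrays 16 and 17 receive twice the optimal half-integral solution. -/
def solution : Program :=
  forLoop 0 30
    (seq (forLoop 0 31 (branch (and (Expr.adj 30 31) (sub (var 14) (entry 8 31)))
      (assign 16 (var 30) (const 1)) skip))
    (seq (branch (sub (entry 8 30) (var 14))
        (assign 16 (var 30) (add (entry 16 30) (const 1))) skip)
      (assign 17 (var 30) (entry 16 30))))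

open Classical in
theorem exec_solution {m : Memory} (hG : EncodesGraph G (m 0) (m 5) (m 6) (m 7))
    (h16 : ∀ i, m 16 i = 0) {m' : Memory} (hm' : m' = solution.exec m) (u : Fin n) :
    m' 16 u = (if ∃ w, G.Adj u w ∧ m 8 w < m 14 0 then 1 else 0)
      + (if m 14 0 < m 8 u then 1 else 0) ∧ m' 17 u = m' 16 u := by
  set r := forLoop 0 31 (branch (and (Expr.adj 30 31) (sub (var 14) (entry 8 31)))
      (assign 16 (var 30) (const 1)) skip) with hr
  set p := seq r
    (seq (branch (sub (entry 8 30) (var 14))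
        (assign 16 (var 30) (add (entry 16 30) (const 1))) skip)
      (assign 17 (var 30) (entry 16 30))) with hp
  have hw : p.writes = [31, 16, 31, 16, 17] := rfl
  have hinner : ∀ x : Memory, (∀ a, a ≠ 30 → a ≠ 31 → a ≠ 16 → a ≠ 17 → x a = m a) →
      ∀ u : Fin n, x 30 0 = u → x 16 u = 0 →
      (∀ w : Fin n, w ≠ u → r.exec x 16 w = x 16 w) ∧
        r.exec x 16 u = if ∃ w, G.Adj u w ∧ m 8 w < m 14 0 then 1 else 0 := by
    intro x hx u hu h0
    have := exec_forLoop_induct (b := 0) (c := 31) (m := x)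
      (p := branch (and (Expr.adj 30 31) (sub (var 14) (entry 8 31)))
        (assign 16 (var 30) (const 1)) skip) (by norm_num) (by simp [writes])
      (fun k m' => (∀ w : Fin n, w ≠ u → m' 16 w = x 16 w) ∧
        m' 16 u = if ∃ w : Fin n, (w : ℕ) < k ∧ G.Adj u w ∧ m 8 w < m 14 0 then 1 else 0)
      (fun _ _ _ h => h) ⟨fun _ _ => rfl, by simp [h0]⟩ ?_
    · rw [hx 0 (by norm_num) (by norm_num) (by norm_num) (by norm_num), hG.size] at this
      refine ⟨this.1, ?_⟩
      rw [this.2]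
      simp only [Fin.is_lt, true_and]
    · intro k hk y h1 h2 ⟨h3, h4⟩
      rw [hx 0 (by norm_num) (by norm_num) (by norm_num) (by norm_num), hG.size] at hk
      have hfr : ∀ a, a ≠ 30 → a ≠ 31 → a ≠ 16 → a ≠ 17 → y a = m a := fun a e1 e2 e3 e4 => by
        rw [h2 a e2 (by simp [writes, e3]), hx a e1 e2 e3 e4]
      have hu' : y 30 0 = u := by rw [h2 30 (by norm_num) (by simp [writes]), hu]
      have hG' : EncodesGraph G (y 0) (y 5) (y 6) (y 7) := by
        rw [hfr 0, hfr 5, hfr 6, hfr 7] <;> first | exact hG | norm_num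
      have hiff : (and (Expr.adj 30 31) (sub (var 14) (entry 8 31))).Holds y ↔
          G.Adj u ⟨k, hk⟩ ∧ m 8 k < m 14 0 := by
        rw [holds_and, holds_adj hG' hu' (v := ⟨k, hk⟩) h1, holds_sub, eval_entry, eval_var, h1,
          hfr 8, hfr 14] <;> norm_num
      rw [exec_branch]
      by_cases hc : (and (Expr.adj 30 31) (sub (var 14) (entry 8 31))).Holds y
      · rw [if_pos hc]
        rw [hiff] at hc
        have e : (assign 16 (var 30) (const 1)).exec y 16 = Function.update (y 16) u 1 := by
          simp [exec, eval, hu']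
        rw [e]
        refine ⟨fun w hw => ?_, ?_⟩
        · rw [Function.update_of_ne (fun h => hw (Fin.ext h)), h3 w hw]
        · rw [Function.update_self, if_pos ⟨⟨k, hk⟩, by simp, hc⟩]
      · rw [if_neg hc]
        rw [hiff] at hc
        refine ⟨h3, ?_⟩
        change y 16 u = _
        rw [h4]
        refine if_congr ⟨?_, ?_⟩ rfl rfl
        · rintro ⟨w, hw, h⟩; exact ⟨w, by omega, h⟩
        · rintro ⟨w, hw, h⟩
          refine ⟨w, ?_, h⟩
          by_contra hwk
          have : w = ⟨k, hk⟩ := Fin.ext (by simp; omega)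
          subst this
          exact hc h
  -- The entries not yet reached must remain 0, because the inner loop writes only when it finds a
  -- suitable neighbour.
  have := exec_forLoop_induct (b := 0) (c := 30) (m := m) (p := p) (by norm_num) (by simp [hw])
    (fun k m' => ∀ u : Fin n, ((u : ℕ) < k →
      m' 16 u = (if ∃ w, G.Adj u w ∧ m 8 w < m 14 0 then 1 else 0)
        + (if m 14 0 < m 8 u then 1 else 0) ∧ m' 17 u = m' 16 u) ∧ (k ≤ u → m' 16 u = 0))
    (fun _ _ _ h => h) (fun u => ⟨by simp, fun _ => h16 u⟩) ?_
  · rw [hG.size] at this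
    rw [hm']
    exact (this u).1 u.2
  · intro k hk x h1 h2 h3
    rw [hG.size] at hk
    have hfr : ∀ a, a ≠ 30 → a ≠ 31 → a ≠ 16 → a ≠ 17 → x a = m a := fun a e1 e2 e3 e4 =>
      h2 a e1 (by simp [hw, e2, e3, e4])
    obtain ⟨h4, h5⟩ := hinner x hfr ⟨k, hk⟩ h1 ((h3 ⟨k, hk⟩).2 le_rfl)
    set y := r.exec x with hy
    have hfry : ∀ a, a ≠ 31 → a ≠ 16 → y a = x a := fun a e1 e2 =>
      exec_of_not_mem_writes _ _ (by simp [hr, forLoop, writes, e1, e2])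
    have e30 : y 30 0 = k := by rw [hfry 30 (by norm_num) (by norm_num), h1]
    have e8 : y 8 = m 8 := by
      rw [hfry 8 (by norm_num) (by norm_num),
        hfr 8 (by norm_num) (by norm_num) (by norm_num) (by norm_num)]
    have e14 : y 14 = m 14 := by
      rw [hfry 14 (by norm_num) (by norm_num),
        hfr 14 (by norm_num) (by norm_num) (by norm_num) (by norm_num)]
    have e17 : y 17 = x 17 := hfry 17 (by norm_num) (by norm_num)
    set z := (branch (sub (entry 8 30) (var 14))
        (assign 16 (var 30) (add (entry 16 30) (const 1))) skip).exec y with hz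
    have z30 : z 30 = y 30 := exec_of_not_mem_writes _ _ (by simp [writes])
    have z17 : z 17 = y 17 := exec_of_not_mem_writes _ _ (by simp [writes])
    have z16 : z 16 = Function.update (y 16) k (y 16 k + if m 14 0 < m 8 k then 1 else 0) := by
      rw [hz, exec_branch]
      simp only [holds_sub, eval_entry, eval_var, e30, e8, e14]
      split_ifs
      · simp [exec, eval, e30]
      · simp [exec]
    have hfin : p.exec x = (assign 17 (var 30) (entry 16 30)).exec z := rfl
    have f16 : p.exec x 16 = z 16 := by rw [hfin]; rfl
    have f17 : p.exec x 17 = Function.update (y 17) k (z 16 k) := by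
      rw [hfin]
      simp [exec, z30, e30, z17]
    intro u
    rw [f16, f17, z16, e17]
    by_cases huk : (u : ℕ) = k
    · have hu : u = ⟨k, hk⟩ := Fin.ext huk
      subst hu
      simp [h5]
    · have hu : u ≠ ⟨k, hk⟩ := fun h => huk (congrArg Fin.val h)
      rw [Function.update_of_ne huk, Function.update_of_ne huk, h4 u hu]
      exact ⟨fun h => (h3 u).1 (by omega), fun h => (h3 u).2 (by omega)⟩

/-! ### Rounding the solution -/

/-- Array 17 holds doubled values, so the entry 1 stands for `1/2`. -/
def lowExpr (c : ℕ) : Expr :=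
  add (and (eq (entry 7 c) (const 2)) (eq (entry 17 c) (const 1))) (eq (entry 7 c) (const 1))

/-- Array 19 receives the set `V'`. -/
def closure : Program :=
  forLoop 0 30 (seq (assign 19 (var 30) (lowExpr 30))
    (forLoop 0 31 (branch (and (lowExpr 31) (Expr.adj 31 30)) (assign 19 (var 30) (const 1)) skip)))

theorem holds_lowExpr {m : Memory} (hG : EncodesGraph G (m 0) (m 5) (m 6) (m 7)) {x : Fin n → ℝ}
    (hx : ∀ v : Fin n, (m 17 v : ℝ) = 2 * x v) {c : ℕ} {v : Fin n} (hc : m c 0 = v) :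
    (lowExpr c).Holds m ↔ v ∈ lowSet G x := by
  have : m 17 v = 1 ↔ x v = 1 / 2 := by
    have := hx v
    constructor
    · intro h
      rw [h] at this
      push_cast at this
      linarith
    · intro h
      rw [h] at this
      norm_num at this
      exact_mod_cast this
  simp only [lowExpr, holds_add, holds_and, holds_eq, eval_entry, hc, hG.deg, lowSet,
    Set.mem_ofPred_eq, ← this]
  rfl

theorem exec_closure {m : Memory} (hG : EncodesGraph G (m 0) (m 5) (m 6) (m 7)) {x : Fin n → ℝ}
    (hx : ∀ v : Fin n, (m 17 v : ℝ) = 2 * x v) {m' : Memory} (hm' : m' = closure.exec m)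
    (u : Fin n) : m' 19 u ≠ 0 ↔ u ∈ lowClosure G x := by
  set r := forLoop 0 31 (branch (and (lowExpr 31) (Expr.adj 31 30))
    (assign 19 (var 30) (const 1)) skip) with hr
  set p := seq (assign 19 (var 30) (lowExpr 30)) r with hp
  have hw : p.writes = [19, 31, 19, 31] := rfl
  have hinner : ∀ y : Memory, (∀ a, a ≠ 30 → a ≠ 31 → a ≠ 19 → y a = m a) →
      ∀ u : Fin n, y 30 0 = u → (∀ w : Fin n, w ≠ u → r.exec y 19 w = y 19 w) ∧
        (r.exec y 19 u ≠ 0 ↔ y 19 u ≠ 0 ∨ ∃ w ∈ lowSet G x, G.Adj w u) := by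
    intro y hy u hu
    have := exec_forLoop_induct (b := 0) (c := 31) (m := y)
      (p := branch (and (lowExpr 31) (Expr.adj 31 30)) (assign 19 (var 30) (const 1)) skip)
      (by norm_num) (by simp [writes])
      (fun k m' => (∀ w : Fin n, w ≠ u → m' 19 w = y 19 w) ∧
        (m' 19 u ≠ 0 ↔ y 19 u ≠ 0 ∨ ∃ w : Fin n, (w : ℕ) < k ∧ w ∈ lowSet G x ∧ G.Adj w u))
      (fun _ _ _ h => h) ⟨fun _ _ => rfl, by simp⟩ ?_
    · rw [hy 0 (by norm_num) (by norm_num) (by norm_num), hG.size] at this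
      refine ⟨this.1, this.2.trans ?_⟩
      simp only [Fin.is_lt, true_and]
    · intro k hk z h1 h2 ⟨h3, h4⟩
      rw [hy 0 (by norm_num) (by norm_num) (by norm_num), hG.size] at hk
      have hfr : ∀ a, a ≠ 30 → a ≠ 31 → a ≠ 19 → z a = m a := fun a e1 e2 e3 => by
        rw [h2 a e2 (by simp [writes, e3]), hy a e1 e2 e3]
      have hu' : z 30 0 = u := by rw [h2 30 (by norm_num) (by simp [writes]), hu]
      have hG' : EncodesGraph G (z 0) (z 5) (z 6) (z 7) := by
        rw [hfr 0, hfr 5, hfr 6, hfr 7] <;> first | exact hG | norm_num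
      have hx' : ∀ v : Fin n, (z 17 v : ℝ) = 2 * x v := by
        rw [hfr 17 (by norm_num) (by norm_num) (by norm_num)]; exact hx
      have hiff : (and (lowExpr 31) (Expr.adj 31 30)).Holds z ↔
          (⟨k, hk⟩ : Fin n) ∈ lowSet G x ∧ G.Adj ⟨k, hk⟩ u := by
        rw [holds_and, holds_lowExpr hG' hx' (v := ⟨k, hk⟩) h1,
          holds_adj hG' (u := ⟨k, hk⟩) h1 hu']
      rw [exec_branch]
      by_cases hc : (and (lowExpr 31) (Expr.adj 31 30)).Holds z
      · rw [if_pos hc]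
        rw [hiff] at hc
        have e : (assign 19 (var 30) (const 1)).exec z 19 = Function.update (z 19) u 1 := by
          simp [exec, eval, hu']
        rw [e]
        refine ⟨fun w hw => ?_, ?_⟩
        · rw [Function.update_of_ne (fun h => hw (Fin.ext h)), h3 w hw]
        · rw [Function.update_self]
          exact ⟨fun _ => .inr ⟨⟨k, hk⟩, by simp, hc⟩, fun _ => one_ne_zero⟩
      · rw [if_neg hc]
        rw [hiff] at hc
        refine ⟨h3, h4.trans (or_congr_right ⟨?_, ?_⟩)⟩
        · rintro ⟨w, hw, h⟩; exact ⟨w, by omega, h⟩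
        · rintro ⟨w, hw, h⟩
          refine ⟨w, ?_, h⟩
          by_contra hwk
          have : w = ⟨k, hk⟩ := Fin.ext (by simp; omega)
          subst this
          exact hc h
  have := exec_forLoop_induct (b := 0) (c := 30) (m := m) (p := p) (by norm_num) (by simp [hw])
    (fun k m' => ∀ u : Fin n, (u : ℕ) < k → (m' 19 u ≠ 0 ↔ u ∈ lowClosure G x))
    (fun _ _ _ h => h) (by simp) ?_
  · rw [hG.size] at this
    rw [hm']
    exact this u u.2
  · intro k hk y h1 h2 h3 u huk
    rw [hG.size] at hk
    have hfr : ∀ a, a ≠ 30 → a ≠ 31 → a ≠ 19 → y a = m a := fun a e1 e2 e3 =>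
      h2 a e1 (by simp [hw, e2, e3])
    have hG' : EncodesGraph G (y 0) (y 5) (y 6) (y 7) := by
      rw [hfr 0, hfr 5, hfr 6, hfr 7] <;> first | exact hG | norm_num
    have hx' : ∀ v : Fin n, (y 17 v : ℝ) = 2 * x v := by
      rw [hfr 17 (by norm_num) (by norm_num) (by norm_num)]; exact hx
    have hlow := holds_lowExpr hG' hx' (v := ⟨k, hk⟩) h1
    set z := (assign 19 (var 30) (lowExpr 30)).exec y with hz
    have hfrz : ∀ a, a ≠ 19 → z a = y a := fun a e =>
      exec_of_not_mem_writes _ _ (by simp [writes, e])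
    have z19 : z 19 = Function.update (y 19) k ((lowExpr 30).eval y) := by
      simp [hz, exec, h1]
    obtain ⟨h4, h5⟩ := hinner z (fun a e1 e2 e3 => by rw [hfrz a e3, hfr a e1 e2 e3])
      ⟨k, hk⟩ (by rw [hfrz 30 (by norm_num), h1])
    have hfin : p.exec y = r.exec z := rfl
    rw [hfin]
    by_cases huk' : (u : ℕ) = k
    · have hu : u = ⟨k, hk⟩ := Fin.ext huk'
      subst hu
      rw [h5, z19, Function.update_self]
      exact or_congr_left hlow
    · have hu : u ≠ ⟨k, hk⟩ := fun h => huk' (congrArg Fin.val h)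
      rw [h4 u hu, z19, Function.update_of_ne huk']
      exact h3 u (by omega)

end Solution

/-! ### Simulation of the rounding steps by loops over tuples -/

section RoundingProgram

/-- Nested loops thus become one fold over tuples, whose lexicographic order is an admissible
visiting order. -/
theorem foldl_sprod {α β S : Type} (l₁ : List α) (l₂ : List β) (f : S → α × β → S) (s : S) :
    (l₁ ×ˢ l₂).foldl f s = l₁.foldl (fun s a => l₂.foldl (fun s b => f s (a, b)) s) s := by
  simp only [SProd.sprod, List.product, List.foldl_flatMap, List.foldl_map]

open Classical in
/-- Running through all the indices and treating the candidates among them. -/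
theorem forAll_foldl {ι S : Type} {L : List ι} (hL : L.Nodup) (hmem : ∀ i, i ∈ L) (cands : Set ι)
    (body : S → ι → S) (s : S) :
    ForAll cands body s (L.foldl (fun s i => if i ∈ cands then body s i else s) s) := by
  refine ⟨L.filter (· ∈ cands), hL.filter _, fun i => by simp [hmem], ?_⟩
  rw [List.foldl_filter]
  simp

variable {n : ℕ} {G : Multigraph (Fin n)} {W : Set (Fin n)} {s : RoundState (Fin n)} {m : Memory}

/-- The memory holds the graph `G`, the set `W` in array 19 and the state `s` in the arrays 16
(the doubled values) and 20 (the processed vertices). -/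
structure EncodesState (G : Multigraph (Fin n)) (W : Set (Fin n)) (s : RoundState (Fin n))
    (m : Memory) : Prop where
  graph : EncodesGraph G (m 0) (m 5) (m 6) (m 7)
  closure : ∀ v : Fin n, m 19 v ≠ 0 ↔ v ∈ W
  y : ∀ v : Fin n, (m 16 v : ℝ) = 2 * s.y v
  le_two : ∀ v : Fin n, m 16 v ≤ 2
  processed : ∀ v : Fin n, m 20 v ≠ 0 ↔ v ∈ s.processed

/-- Arrays from 21 on hold only loop variables, so advancing a counter does not affect the encoded
state. -/
theorem EncodesState.update (h : EncodesState G W s m) {c : ℕ} (hc : 21 ≤ c) (f : ℕ → ℕ) :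
    EncodesState G W s (Function.update m c f) := by
  have e : ∀ a, a < 21 → Function.update m c f a = m a := fun a ha =>
    Function.update_of_ne (by omega) _ _
  refine ⟨?_, ?_, ?_, ?_, ?_⟩
  · rw [e 0, e 5, e 6, e 7] <;> first | exact h.graph | norm_num
  · rw [e 19 (by norm_num)]; exact h.closure
  · rw [e 16 (by norm_num)]; exact h.y
  · rw [e 16 (by norm_num)]; exact h.le_two
  · rw [e 20 (by norm_num)]; exact h.processed

theorem EncodesState.congr {m' : Memory} (h : EncodesState G W s m)
    (e : ∀ a ∈ [0, 5, 6, 7, 16, 19, 20], m' a = m a) : EncodesState G W s m' := by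
  simp only [List.mem_cons, List.not_mem_nil, or_false, forall_eq_or_imp, forall_eq] at e
  obtain ⟨e0, e5, e6, e7, e16, e19, e20⟩ := e
  refine ⟨?_, ?_, ?_, ?_, ?_⟩
  · rw [e0, e5, e6, e7]; exact h.graph
  · rw [e19]; exact h.closure
  · rw [e16]; exact h.y
  · rw [e16]; exact h.le_two
  · rw [e20]; exact h.processed

/-- The vertex in the variable `c` receives the value `k / 2`. -/
def setValue (c k : ℕ) : Program := assign 16 (var c) (const k)

def setProcessed (c : ℕ) : Program := assign 20 (var c) (const 1)

/-- The memory `x` encodes the state `s` and has the same variables as the memory `m`. -/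
structure Tracks (G : Multigraph (Fin n)) (W : Set (Fin n)) (m : Memory) (s : RoundState (Fin n))
    (x : Memory) : Prop where
  state : EncodesState G W s x
  vars : ∀ c, 21 ≤ c → x c = m c

theorem EncodesState.tracks (h : EncodesState G W s m) : Tracks G W m s m := ⟨h, fun _ _ => rfl⟩

theorem Tracks.setValue {x : Memory} (h : Tracks G W m s x) {c k : ℕ} {v : Fin n} (hc : 21 ≤ c)
    (hv : m c 0 = v) (hk : k ≤ 2) :
    Tracks G W m ⟨Function.update s.y v (k / 2), s.processed⟩ ((setValue c k).exec x) := by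
  have hf : ∀ a, a ≠ 16 → (PowerLawVC.setValue c k).exec x a = x a := fun a ha =>
    exec_of_not_mem_writes _ _ (by simp [PowerLawVC.setValue, writes, ha])
  have e16 : (PowerLawVC.setValue c k).exec x 16 = Function.update (x 16) v k := by
    simp [PowerLawVC.setValue, exec, eval, h.vars c hc, hv]
  refine ⟨⟨?_, ?_, fun w => ?_, fun w => ?_, ?_⟩, fun a ha => ?_⟩
  · rw [hf 0, hf 5, hf 6, hf 7] <;> first | exact h.state.graph | norm_num
  · rw [hf 19 (by norm_num)]; exact h.state.closure
  · rw [e16]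
    simp only [Function.update_apply, Fin.val_inj]
    split_ifs
    · ring
    · exact h.state.y w
  · rw [e16]
    simp only [Function.update_apply, Fin.val_inj]
    split_ifs
    · exact hk
    · exact h.state.le_two w
  · rw [hf 20 (by norm_num)]; exact h.state.processed
  · rw [hf a (by omega), h.vars a ha]

theorem Tracks.setProcessed {x : Memory} (h : Tracks G W m s x) {c : ℕ} {v : Fin n} (hc : 21 ≤ c)
    (hv : m c 0 = v) : Tracks G W m ⟨s.y, insert v s.processed⟩ ((setProcessed c).exec x) := by
  have hf : ∀ a, a ≠ 20 → (PowerLawVC.setProcessed c).exec x a = x a := fun a ha =>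
    exec_of_not_mem_writes _ _ (by simp [PowerLawVC.setProcessed, writes, ha])
  have e20 : (PowerLawVC.setProcessed c).exec x 20 = Function.update (x 20) v 1 := by
    simp [PowerLawVC.setProcessed, exec, eval, h.vars c hc, hv]
  refine ⟨⟨?_, ?_, ?_, ?_, fun w => ?_⟩, fun a ha => ?_⟩
  · rw [hf 0, hf 5, hf 6, hf 7] <;> first | exact h.state.graph | norm_num
  · rw [hf 19 (by norm_num)]; exact h.state.closure
  · rw [hf 16 (by norm_num)]; exact h.state.y
  · rw [hf 16 (by norm_num)]; exact h.state.le_two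
  · rw [e20]
    simp only [Function.update_apply, Fin.val_inj, Finset.mem_insert]
    split_ifs with hw
    · simp [hw]
    · simp [hw, h.state.processed w]
  · rw [hf a (by omega), h.vars a ha]

theorem EncodesState.holds_processed (h : EncodesState G W s m) {c : ℕ} {v : Fin n}
    (hc : m c 0 = v) : (entry 20 c).Holds m ↔ v ∈ s.processed := by
  rw [holds_entry, hc, h.processed]

theorem exec_forLoop_sprod {c : ℕ} {p : Program} (hn : m 0 0 = n) (h0c : 0 ≠ c)
    (hc : c ∉ p.writes) {S ι : Type} (R : S → Memory → Prop) (L : List ι) (f : S → Fin n × ι → S)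
    (hR : ∀ s m' g, R s m' → R s (Function.update m' c g)) {s : S} (h0 : R s m)
    (hs : ∀ (i : Fin n) (s : S) (m' : Memory), m' c 0 = (i : ℕ) → R s m' →
      R (L.foldl (fun s b => f s (i, b)) s) (p.exec m')) :
    R ((List.finRange n ×ˢ L).foldl f s) ((forLoop 0 c p).exec m) := by
  rw [foldl_sprod]
  exact exec_forLoop_foldl hn h0c hc R _ hR h0 hs

/-! Step 1 -/

def treat1 : Program :=
  seq (setValue 30 0) (seq (setValue 31 2) (seq (setProcessed 30) (setProcessed 31)))

def step1 : Program :=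
  forLoop 0 30 (forLoop 0 31
    (branch (and (eq (entry 7 30) (const 1)) (Expr.adj 30 31)) treat1 skip))

theorem exec_treat1 (h : EncodesState G W s m) {v u : Fin n} (hv : m 30 0 = v)
    (hu : m 31 0 = u) : Tracks G W m (body1 s (v, u)) (treat1.exec m) := by
  have h1 := (((h.tracks.setValue (k := 0) (by norm_num) hv (by norm_num)).setValue (k := 2)
    (by norm_num) hu le_rfl).setProcessed (by norm_num) hv).setProcessed (by norm_num) hu
  have e : body1 s (v, u) = ⟨Function.update (Function.update s.y v ((0 : ℕ) / 2)) u ((2 : ℕ) / 2),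
      insert u (insert v s.processed)⟩ := by
    simp only [body1, RoundState.mk.injEq]
    refine ⟨by norm_num, ?_⟩
    grind
  rw [e]
  simp only [treat1, exec]
  exact h1

theorem exec_step1 (h : EncodesState G W s m) :
    ∃ s', ForAll (cands1 G) body1 s s' ∧ EncodesState G W s' (step1.exec m) := by
  classical
  refine ⟨_, forAll_foldl (L := List.finRange n ×ˢ List.finRange n)
    ((List.nodup_finRange n).product (List.nodup_finRange n)) (by simp) _ _ _,
    exec_forLoop_sprod (c := 30) h.graph.size (by norm_num) (by decide) (EncodesState G W) _ _
      (fun s m' g h => h.update (by norm_num) g) h fun v s m hv h => ?_⟩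
  refine (exec_forLoop_foldl (c := 31) h.graph.size (by norm_num) (by decide)
    (fun s m => EncodesState G W s m ∧ m 30 0 = v) _
    (fun s m' g h => ⟨h.1.update (by norm_num) g, h.2⟩) ⟨h, hv⟩ fun u s m hu h => ?_).1
  obtain ⟨h, hv⟩ := h
  have hiff : (and (eq (entry 7 30) (const 1)) (Expr.adj 30 31)).Holds m ↔ (v, u) ∈ cands1 G := by
    rw [holds_and, holds_adj h.graph hv hu, holds_eq, eval_entry, hv, h.graph.deg]
    rfl
  rw [exec_branch, if_congr hiff rfl rfl]
  split_ifs
  · have h1 := exec_treat1 h hv hu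
    exact ⟨h1.state, by rw [h1.vars 30 (by norm_num), hv]⟩
  · exact ⟨h, hv⟩

/-! Step 2 -/

def treat2 : Program :=
  branch (and (not (entry 20 30)) (and (not (entry 20 31))
      (and (not (entry 20 32)) (not (entry 20 33)))))
    (seq (setValue 30 2) (seq (setValue 33 2) (seq (setValue 31 2) (seq (setValue 32 0)
    (seq (setProcessed 30) (seq (setProcessed 31) (seq (setProcessed 32) (setProcessed 33))))))))
    skip

def differ (c d : ℕ) : Expr := not (eq (var c) (var d))

/-- By truncated subtraction, `deg - 2` is nonzero exactly when the degree is at least 3. -/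
def pathExpr : Expr :=
  and (and (differ 30 31) (and (differ 30 32) (and (differ 30 33) (and (differ 31 32)
    (and (differ 31 33) (differ 32 33))))))
  (and (and (entry 19 30) (and (entry 19 31) (and (entry 19 32) (entry 19 33))))
  (and (and (Expr.adj 30 31) (and (Expr.adj 31 32) (Expr.adj 32 33)))
  (and (sub (entry 7 30) (const 2)) (and (eq (entry 7 31) (const 2)) (eq (entry 7 32) (const 2))))))

def step2 : Program :=
  forLoop 0 30 (forLoop 0 31 (forLoop 0 32 (forLoop 0 33 (branch pathExpr treat2 skip))))

theorem exec_treat2 (h : EncodesState G W s m) {u v₁ v₂ w : Fin n} (hu : m 30 0 = u)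
    (h₁ : m 31 0 = v₁) (h₂ : m 32 0 = v₂) (hw : m 33 0 = w) :
    Tracks G W m (body2 s (u, v₁, v₂, w)) (treat2.exec m) := by
  have hiff : (and (not (entry 20 30)) (and (not (entry 20 31))
      (and (not (entry 20 32)) (not (entry 20 33))))).Holds m ↔
      u ∉ s.processed ∧ v₁ ∉ s.processed ∧ v₂ ∉ s.processed ∧ w ∉ s.processed := by
    simp only [holds_and, holds_not, h.holds_processed hu, h.holds_processed h₁,
      h.holds_processed h₂, h.holds_processed hw]
  rw [treat2, exec_branch, if_congr hiff rfl rfl, body2]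
  split_ifs
  · have h1 := h.tracks.setValue (k := 2) (by norm_num) hu le_rfl
    have h2 := h1.setValue (k := 2) (by norm_num) hw le_rfl
    dsimp only at h2
    have h3 := h2.setValue (k := 2) (by norm_num) h₁ le_rfl
    dsimp only at h3
    have h4 := h3.setValue (k := 0) (by norm_num) h₂ (by norm_num)
    dsimp only at h4
    have h5 := h4.setProcessed (by norm_num) hu
    dsimp only at h5
    have h6 := h5.setProcessed (by norm_num) h₁
    dsimp only at h6
    have h7 := h6.setProcessed (by norm_num) h₂
    dsimp only at h7
    have h8 := h7.setProcessed (by norm_num) hw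
    dsimp only at h8
    have e2 : (((2 : ℕ) : ℝ) / 2) = 1 := by norm_num
    have e0 : (((0 : ℕ) : ℝ) / 2) = 0 := by norm_num
    rw [e2, e0] at h8
    have e : s.processed ∪ {u, v₁, v₂, w}
        = insert w (insert v₂ (insert v₁ (insert u s.processed))) := by
      grind
    rw [e]
    simp only [exec]
    exact h8
  · exact h.tracks

theorem exec_step2 {x : Fin n → ℝ} (h : EncodesState G (lowClosure G x) s m) :
    ∃ s', ForAll (cands2 G x) body2 s s' ∧ EncodesState G (lowClosure G x) s' (step2.exec m) := by
  classical
  have hnd := List.nodup_finRange n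
  refine ⟨_, forAll_foldl
    (L := List.finRange n ×ˢ (List.finRange n ×ˢ (List.finRange n ×ˢ List.finRange n)))
    (hnd.product (hnd.product (hnd.product hnd))) (by simp) _ _ _,
    exec_forLoop_sprod (c := 30) h.graph.size (by norm_num) (by decide) (EncodesState G _) _ _
      (fun s m' g h => h.update (by norm_num) g) h fun u s m hu h => ?_⟩
  refine (exec_forLoop_sprod (c := 31) h.graph.size (by norm_num) (by decide)
    (fun s m => EncodesState G (lowClosure G x) s m ∧ m 30 0 = u) _ _
    (fun s m' g h => ⟨h.1.update (by norm_num) g, h.2⟩) ⟨h, hu⟩ fun v₁ s m h₁ h => ?_).1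
  refine (exec_forLoop_sprod (c := 32) h.1.graph.size (by norm_num) (by decide)
    (fun s m => EncodesState G (lowClosure G x) s m ∧ m 30 0 = u ∧ m 31 0 = v₁) _ _
    (fun s m' g h => ⟨h.1.update (by norm_num) g, h.2⟩) ⟨h.1, h.2, h₁⟩ fun v₂ s m h₂ h => ?_).imp_right
      And.left
  refine (exec_forLoop_foldl (c := 33) h.1.graph.size (by norm_num) (by decide)
    (fun s m => EncodesState G (lowClosure G x) s m ∧ m 30 0 = u ∧ m 31 0 = v₁ ∧ m 32 0 = v₂) _
    (fun s m' g h => ⟨h.1.update (by norm_num) g, h.2⟩) ⟨h.1, h.2.1, h.2.2, h₂⟩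
    fun w s m hw h => ?_).imp_right fun h => ⟨h.1, h.2.1⟩
  obtain ⟨h, hu, h₁, h₂⟩ := h
  have hiff : pathExpr.Holds m ↔ (u, v₁, v₂, w) ∈ cands2 G x := by
    simp only [pathExpr, differ, holds_and, holds_not, holds_eq, holds_sub, eval_entry, eval_var,
      holds_entry, holds_adj h.graph hu h₁, holds_adj h.graph h₁ h₂, holds_adj h.graph h₂ hw, hu,
      h₁, h₂, hw, h.closure, h.graph.deg, Fin.val_inj, eval]
    simp only [cands2, Set.mem_ofPred_eq, List.nodup_cons, List.mem_cons, List.not_mem_nil,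
      or_false, not_or, forall_eq_or_imp, forall_eq, Nat.succ_le_iff]
    simp only [List.nodup_nil, not_false_iff, and_true, and_assoc]
  rw [exec_branch, if_congr hiff rfl rfl]
  split_ifs
  · have h1 := exec_treat2 h hu h₁ h₂ hw
    refine ⟨h1.state, ?_⟩
    rw [h1.vars 30 (by norm_num), h1.vars 31 (by norm_num), h1.vars 32 (by norm_num)]
    exact ⟨hu, h₁, h₂⟩
  · exact ⟨h, hu, h₁, h₂⟩

/-! Steps 3 and 4 -/

/-- The variable 12 tells whether the neighbourhood of the vertex 31 consists of the vertices
30 and 32. -/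
def testNeighbors : Program :=
  seq (assign 12 (const 0) (const 1))
    (forLoop 0 33 (branch (eq (not (Expr.adj 31 33))
        (not (add (eq (var 33) (var 30)) (eq (var 33) (var 32))))) skip
      (assign 12 (const 0) (const 0))))

/-- Negation normalises truth values to 0 and 1, so an equivalence can be tested as an equality of
numbers. -/
theorem eval_not {e f : Expr} : (not e).eval m = (not f).eval m ↔ (e.Holds m ↔ f.Holds m) := by
  simp only [Expr.not, eval, Holds]
  omega

theorem exec_testNeighbors (hG : EncodesGraph G (m 0) (m 5) (m 6) (m 7)) {u v w : Fin n}
    (hu : m 30 0 = u) (hv : m 31 0 = v) (hw : m 32 0 = w) :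
    testNeighbors.exec m 12 0 ≠ 0 ↔ ∀ t, G.Adj v t ↔ t = u ∨ t = w := by
  set m₁ := (assign 12 (const 0) (const 1)).exec m with hm₁
  have hfr : ∀ a, a ≠ 12 → m₁ a = m a := fun a h =>
    exec_of_not_mem_writes _ _ (by simp [writes, h])
  have := exec_forLoop_induct (b := 0) (c := 33) (m := m₁)
    (p := branch (eq (not (Expr.adj 31 33))
        (not (add (eq (var 33) (var 30)) (eq (var 33) (var 32))))) skip
      (assign 12 (const 0) (const 0))) (by norm_num) (by decide)
    (fun k m' => m' 12 0 ≠ 0 ↔ ∀ t : Fin n, (t : ℕ) < k → (G.Adj v t ↔ t = u ∨ t = w))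
    (fun _ _ _ h => h) (by simp [hm₁, exec, eval]) ?_
  · rw [hfr 0 (by norm_num), hG.size] at this
    refine Iff.trans this ?_
    simp only [Fin.is_lt, true_imp_iff]
  · intro k hk y h1 h2 h3
    rw [hfr 0 (by norm_num), hG.size] at hk
    have hfy : ∀ a, a ≠ 12 → a ≠ 33 → y a = m a := fun a e1 e2 => by
      rw [h2 a e2 (by simp [writes, e1]), hfr a e1]
    have hG' : EncodesGraph G (y 0) (y 5) (y 6) (y 7) := by
      rw [hfy 0, hfy 5, hfy 6, hfy 7] <;> first | exact hG | norm_num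
    have h33 : y 33 0 = (⟨k, hk⟩ : Fin n) := h1
    have h30 : y 30 0 = u := by rw [hfy 30 (by norm_num) (by norm_num), hu]
    have h31 : y 31 0 = v := by rw [hfy 31 (by norm_num) (by norm_num), hv]
    have h32 : y 32 0 = w := by rw [hfy 32 (by norm_num) (by norm_num), hw]
    have hiff : (eq (not (Expr.adj 31 33))
        (not (add (eq (var 33) (var 30)) (eq (var 33) (var 32))))).Holds y ↔
        (G.Adj v ⟨k, hk⟩ ↔ (⟨k, hk⟩ : Fin n) = u ∨ (⟨k, hk⟩ : Fin n) = w) := by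
      rw [holds_eq, eval_not, holds_adj hG' h31 h33, holds_add, holds_eq, holds_eq, eval_var,
        eval_var, eval_var, h33, h30, h32, Fin.val_inj, Fin.val_inj]
    rw [exec_branch]
    by_cases hc : (eq (not (Expr.adj 31 33))
        (not (add (eq (var 33) (var 30)) (eq (var 33) (var 32))))).Holds y
    · rw [if_pos hc]
      rw [hiff] at hc
      refine Iff.trans h3 ⟨fun h t ht => ?_, fun h t ht => h t (by omega)⟩
      by_cases htk : (t : ℕ) = k
      · have : t = ⟨k, hk⟩ := Fin.ext htk
        rw [this]
        exact hc
      · exact h t (by omega)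
    · rw [if_neg hc]
      rw [hiff] at hc
      have e : (assign 12 (const 0) (const 0)).exec y 12 0 = 0 := by simp [exec, eval]
      rw [e]
      exact iff_of_false (by simp) fun h => hc (h ⟨k, hk⟩ (by simp))

/-- Vertex 31 gets its 0 before the neighbours get their 1, so a loop ends with value 1. The marks
are set last, because both tests refer to the old set of processed vertices. -/
def treat34 : Program :=
  branch (entry 20 31) skip
    (seq (setValue 31 0)
    (seq (branch (entry 20 30) skip (setValue 30 2))
    (seq (branch (entry 20 32) skip (setValue 32 2))
    (seq (setProcessed 30) (seq (setProcessed 31) (setProcessed 32))))))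

/-- Step 3 or step 4, depending on the condition `e`. -/
def step34 (e : Expr) : Program :=
  forLoop 0 30 (forLoop 0 31 (forLoop 0 32 (seq testNeighbors
    (branch (and e (and (entry 19 31) (and (eq (entry 7 31) (const 2)) (var 12)))) treat34 skip))))

theorem body34_y_eq {u v w : Fin n} (hv : v ∉ s.processed) :
    (body34 s (u, v, w)).y =
      if w ∈ s.processed then
        if u ∈ s.processed then Function.update s.y v 0
        else Function.update (Function.update s.y v 0) u 1
      else Function.update (if u ∈ s.processed then Function.update s.y v 0
        else Function.update (Function.update s.y v 0) u 1) w 1 := by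
  funext t
  rw [body34_y hv]
  by_cases hu : u ∈ s.processed <;> by_cases hw : w ∈ s.processed <;>
    simp only [hu, hw, if_true, if_false, Function.update_apply] <;> grind

theorem exec_treat34 (h : EncodesState G W s m) {u v w : Fin n} (hu : m 30 0 = u)
    (hv : m 31 0 = v) (hw : m 32 0 = w) :
    Tracks G W m (body34 s (u, v, w)) (treat34.exec m) := by
  rw [treat34, exec_branch, if_congr (h.holds_processed hv) rfl rfl]
  split_ifs with hvp
  · simp only [body34, hvp, if_true]
    exact h.tracks
  have step : ∀ (c : ℕ) (a : Fin n) (z : Fin n → ℝ) (x : Memory), 21 ≤ c → m c 0 = a →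
      Tracks G W m ⟨z, s.processed⟩ x →
      Tracks G W m ⟨if a ∈ s.processed then z else Function.update z a 1, s.processed⟩
        ((branch (entry 20 c) skip (setValue c 2)).exec x) := by
    intro c a z x hc ha hx
    rw [exec_branch, if_congr (hx.state.holds_processed (by rw [hx.vars c hc, ha])) rfl rfl]
    split_ifs
    · exact hx
    · have := hx.setValue (k := 2) hc ha le_rfl
      norm_num at this
      exact this
  have h1 := h.tracks.setValue (k := 0) (by norm_num) hv (by norm_num)
  rw [Nat.cast_zero, zero_div] at h1
  have h4 := (((step 32 w _ _ (by norm_num) hw (step 30 u _ _ (by norm_num) hu h1)).setProcessed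
    (by norm_num) hu).setProcessed (by norm_num) hv).setProcessed (by norm_num) hw
  have e : body34 s (u, v, w) = ⟨(body34 s (u, v, w)).y, (body34 s (u, v, w)).processed⟩ := rfl
  have e' : s.processed ∪ {u, v, w} = insert w (insert v (insert u s.processed)) := by
    grind
  rw [e, body34_processed hvp, body34_y_eq hvp, e']
  simp only [exec]
  exact h4

theorem exec_step34 {x : Fin n → ℝ} (e : Expr) (C : Set (Fin n × Fin n × Fin n))
    (he : ∀ (s : RoundState (Fin n)) (m : Memory) (u v w : Fin n),
      EncodesState G (lowClosure G x) s m → m 30 0 = u →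
      (e.Holds m ∧ (u, v, w) ∈ cands4 G x ↔ (u, v, w) ∈ C))
    (h : EncodesState G (lowClosure G x) s m) :
    ∃ s', ForAll C body34 s s' ∧ EncodesState G (lowClosure G x) s' ((step34 e).exec m) := by
  classical
  have hnd := List.nodup_finRange n
  refine ⟨_, forAll_foldl (L := List.finRange n ×ˢ (List.finRange n ×ˢ List.finRange n))
    (hnd.product (hnd.product hnd)) (by simp) _ _ _,
    exec_forLoop_sprod (c := 30) h.graph.size (by norm_num) (by simp [writes, forLoop, testNeighbors,
      treat34, setValue, setProcessed]) (EncodesState G _) _ _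
      (fun s m' g h => h.update (by norm_num) g) h fun u s m hu h => ?_⟩
  refine (exec_forLoop_sprod (c := 31) h.graph.size (by norm_num) (by simp [writes, forLoop, testNeighbors,
      treat34, setValue, setProcessed])
    (fun s m => EncodesState G (lowClosure G x) s m ∧ m 30 0 = u) _ _
    (fun s m' g h => ⟨h.1.update (by norm_num) g, h.2⟩) ⟨h, hu⟩ fun v s m hv h => ?_).1
  refine (exec_forLoop_foldl (c := 32) h.1.graph.size (by norm_num) (by simp [writes, forLoop,
      testNeighbors, treat34, setValue, setProcessed])
    (fun s m => EncodesState G (lowClosure G x) s m ∧ m 30 0 = u ∧ m 31 0 = v) _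
    (fun s m' g h => ⟨h.1.update (by norm_num) g, h.2⟩) ⟨h.1, h.2, hv⟩
    fun w s m hw h => ?_).imp_right And.left
  obtain ⟨h, hu, hv⟩ := h
  rw [exec]
  have htest := exec_testNeighbors h.graph hu hv hw
  set m₁ := testNeighbors.exec m with hm₁
  have hfr : ∀ a, a ≠ 12 → a ≠ 33 → m₁ a = m a := fun a h h' =>
    exec_of_not_mem_writes _ _ (by simp [testNeighbors, forLoop, writes, h, h'])
  have h' : EncodesState G (lowClosure G x) s m₁ := h.congr (by
    simp only [List.mem_cons, List.not_mem_nil, or_false, forall_eq_or_imp, forall_eq]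
    refine ⟨?_, ?_, ?_, ?_, ?_, ?_, ?_⟩ <;> exact hfr _ (by norm_num) (by norm_num))
  have hu' : m₁ 30 0 = u := by rw [hfr 30 (by norm_num) (by norm_num), hu]
  have hv' : m₁ 31 0 = v := by rw [hfr 31 (by norm_num) (by norm_num), hv]
  have hw' : m₁ 32 0 = w := by rw [hfr 32 (by norm_num) (by norm_num), hw]
  have hiff : (and e (and (entry 19 31) (and (eq (entry 7 31) (const 2)) (var 12)))).Holds m₁ ↔
      (u, v, w) ∈ C := by
    rw [← he s m₁ u v w h' hu', holds_and, holds_and, holds_and, holds_entry, hv', h'.closure,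
      holds_eq, eval_entry, hv', h'.graph.deg]
    exact and_congr_right' (and_congr_right' (and_congr_right' htest))
  rw [exec_branch, if_congr hiff rfl rfl]
  split_ifs
  · have h1 := exec_treat34 h' hu' hv' hw'
    refine ⟨h1.state, ?_⟩
    rw [h1.vars 30 (by norm_num), h1.vars 31 (by norm_num)]
    exact ⟨hu', hv'⟩
  · exact ⟨h', hu', hv'⟩

/-! Step 5 and the whole algorithm -/

def writeOutput : Program :=
  forLoop 0 30 (branch (entry 16 30) (assign 4 (var 30) (const 1)) (assign 4 (var 30) (const 0)))

/-- The doubled values are 0, 1 or 2, so rounding up `1/2` amounts to testing for a nonzero entry.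
-/
theorem exec_writeOutput (h : EncodesState G W s m) (v : Fin n) :
    (writeOutput.exec m 4 v : ℝ) = step5 s.y v := by
  have := exec_forLoop_induct (b := 0) (c := 30) (m := m)
    (p := branch (entry 16 30) (assign 4 (var 30) (const 1)) (assign 4 (var 30) (const 0)))
    (by norm_num) (by decide)
    (fun k m' => ∀ v : Fin n, (v : ℕ) < k → m' 4 v = if m 16 v = 0 then 0 else 1)
    (fun _ _ _ h => h) (by simp) ?_
  · rw [h.graph.size] at this
    rw [writeOutput, this v v.2]
    have h1 := h.y v
    have h2 := h.le_two v
    have h3 : m 16 v = 0 ∨ m 16 v = 1 ∨ m 16 v = 2 := by omega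
    rw [step5]
    rcases h3 with h3 | h3 | h3 <;> rw [h3] at h1 ⊢ <;> push_cast at h1
    · have : s.y v = 0 := by linarith
      norm_num [this]
    · have : s.y v = 1 / 2 := by linarith
      norm_num [this]
    · have : s.y v = 1 := by linarith
      norm_num [this]
  · intro k hk x h1 h2 h3 v hv
    have h16 : x 16 = m 16 := h2 16 (by norm_num) (by decide)
    have e : (branch (entry 16 30) (assign 4 (var 30) (const 1))
        (assign 4 (var 30) (const 0))).exec x 4
        = Function.update (x 4) k (if m 16 k = 0 then 0 else 1) := by
      rw [exec_branch]
      simp only [holds_entry, h1, h16]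
      split_ifs <;> simp_all [exec, eval]
    rw [e, Function.update_apply]
    split_ifs with hvk h0 h0 <;> grind

def vertexCover : Program :=
  seq readGraph (seq auction (seq findGap (seq solution (seq closure (seq step1 (seq step2
    (seq (step34 (sub (entry 7 30) (const 2))) (seq (step34 (const 1)) writeOutput))))))))

theorem loopBounded_vertexCover : vertexCover.LoopBounded := by
  simp [vertexCover, readGraph, auction, bid, cheapest, findGap, solution, closure, step1, treat1,
    step2, treat2, step34, testNeighbors, treat34, writeOutput, forLoop, setValue, setProcessed,
    LoopBounded]

theorem isAlgorithmOutput_vertexCover (es : List (Fin n × Fin n)) :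
    IsAlgorithmOutput (graphOfList es) (output vertexCover es) := by
  classical
  set G := graphOfList es
  set m₀ := inputMemory es with hm₀
  -- Work arrays start at 0; this provides the zero prices, the empty set of marks and the empty set
  -- of processed vertices.
  have hzero : ∀ a, 4 ≤ a → ∀ i, m₀ a i = 0 := by
    intro a ha i
    obtain ⟨b, rfl⟩ := Nat.exists_eq_add_of_le ha
    rw [Nat.add_comm]
    rfl
  set m₁ := readGraph.exec m₀ with hm₁
  have hG₁ : EncodesGraph G (m₁ 0) (m₁ 5) (m₁ 6) (m₁ 7) := exec_readGraph es hm₁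
  have f₁ : ∀ a ∉ readGraph.writes, m₁ a = m₀ a := fun a => exec_of_not_mem_writes _ _
  set m₂ := auction.exec m₁ with hm₂
  obtain ⟨hG₂, hI, hS⟩ := exec_auction hG₁
    (fun i => by rw [f₁ 8 (by decide)]; exact hzero 8 (by norm_num) i) hm₂
  have f₂ : ∀ a ∉ auction.writes, m₂ a = m₁ a := fun a => exec_of_not_mem_writes _ _
  set m₃ := findGap.exec m₂ with hm₃
  have f₃ : ∀ a ∉ findGap.writes, m₃ a = m₂ a := fun a => exec_of_not_mem_writes _ _
  obtain ⟨hj, hgap⟩ := exec_findGap hG₂.size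
    (fun i => by
      rw [f₂ 13 (by decide), f₁ 13 (by decide)]; exact hzero 13 (by norm_num) i)
    (by rw [f₂ 14 (by decide), f₁ 14 (by decide)]; exact hzero 14 (by norm_num) 0) hm₃
  have hG₃ : EncodesGraph G (m₃ 0) (m₃ 5) (m₃ 6) (m₃ 7) := by
    rw [f₃ 0 (by decide), f₃ 5 (by decide), f₃ 6 (by decide), f₃ 7 (by decide)]; exact hG₂
  set m₄ := solution.exec m₃ with hm₄
  have f₄ : ∀ a ∉ solution.writes, m₄ a = m₃ a := fun a => exec_of_not_mem_writes _ _
  have hsol := exec_solution hG₃ (fun i => by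
      rw [f₃ 16 (by decide), f₂ 16 (by decide), f₁ 16 (by decide)]
      exact hzero 16 (by norm_num) i) hm₄
  have hG₄ : EncodesGraph G (m₄ 0) (m₄ 5) (m₄ 6) (m₄ 7) := by
    rw [f₄ 0 (by decide), f₄ 5 (by decide), f₄ 6 (by decide), f₄ 7 (by decide)]; exact hG₃
  set x : Fin n → ℝ := fun v => ((if ∃ w, G.Adj v w ∧ m₂ 8 w < m₃ 14 0 then 1 else 0)
      + (if m₃ 14 0 < m₂ 8 v then 1 else 0)) / 2 with hx
  have hopt : G.IsOptimalHalfIntegral x := hI.isOptimalHalfIntegral hS hj hgap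
  have e8 : m₃ 8 = m₂ 8 := f₃ 8 (by decide)
  rw [e8] at hsol
  have h16 : ∀ v : Fin n, (m₄ 16 v : ℝ) = 2 * x v := fun v => by
    rw [(hsol v).1, hx]
    push_cast
    ring
  have h17 : ∀ v : Fin n, (m₄ 17 v : ℝ) = 2 * x v := fun v => by
    rw [(hsol v).2, h16]
  have hle : ∀ v : Fin n, m₄ 16 v ≤ 2 := fun v => by
    rw [(hsol v).1]
    split_ifs <;> norm_num
  set m₅ := closure.exec m₄ with hm₅
  have f₅ : ∀ a ∉ closure.writes, m₅ a = m₄ a := fun a => exec_of_not_mem_writes _ _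
  have hst : EncodesState G (lowClosure G x) ⟨x, ∅⟩ m₅ := by
    refine ⟨?_, exec_closure hG₄ h17 hm₅, ?_, ?_, fun v => ?_⟩
    · rw [f₅ 0 (by decide), f₅ 5 (by decide), f₅ 6 (by decide), f₅ 7 (by decide)]; exact hG₄
    · rw [f₅ 16 (by decide)]; exact h16
    · rw [f₅ 16 (by decide)]; exact hle
    · rw [f₅ 20 (by decide), f₄ 20 (by decide), f₃ 20 (by decide), f₂ 20 (by decide),
        f₁ 20 (by decide), hzero 20 (by norm_num)]
      simp
  obtain ⟨s₁, hs₁, he₁⟩ := exec_step1 hst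
  obtain ⟨s₂, hs₂, he₂⟩ := exec_step2 he₁
  obtain ⟨s₃, hs₃, he₃⟩ := exec_step34 (sub (entry 7 30) (const 2)) (cands3 G x)
    (fun s m u v w h hu => by
      rw [holds_sub, eval_entry, hu, h.graph.deg]
      exact and_comm) he₂
  obtain ⟨s₄, hs₄, he₄⟩ := exec_step34 (const 1) (cands4 G x)
    (fun s m u v w h hu => by simp [Holds, eval]) he₃
  exact ⟨x, hopt, s₁, s₂, s₃, s₄, hs₁, hs₂, hs₃, hs₄, funext fun v => exec_writeOutput he₄ v⟩

end RoundingProgram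
end PowerLawVC

open PowerLawVC
theorem theorem2 :
    -- The algorithm is implemented by a program that runs in polynomial time.
    (∃ (P : Program) (p : Polynomial ℕ), ∀ (n : ℕ) (es : List (Fin n × Fin n)),
      P.steps (inputMemory es) ≤ p.eval (n + es.length) ∧
      IsAlgorithmOutput (graphOfList es) (output P es)) ∧
    -- Every output of the algorithm is the indicator function of a vertex cover.
    (∀ (n : ℕ) (G : Multigraph (Fin n)) (y : Fin n → ℝ), IsAlgorithmOutput G y →
      ∃ C : Finset (Fin n), G.IsVertexCover C ∧ ∀ v, y v = if v ∈ C then 1 else 0) ∧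
    -- The expected approximation ratio, for any outputs of the algorithm, as `α → ∞`.
    (∀ β : ℝ, 2.424 < β →
      ∀ y : (α : ℝ) → PerfectMatching (Copies α β) → Fin (numVertices α β) → ℝ,
        (∀ α σ, IsAlgorithmOutput (matchingGraph σ) (y α σ)) →
        ∀ ε : ℝ, 0 < ε → ∀ᶠ α : ℝ in atTop,
          modelExpectation α β
            (fun σ => (∑ v, y α σ v) / ((matchingGraph σ).opt : ℝ)) ≤ refinedRatio β + ε) ∧
    -- This ratio is better than that of the first analysis.
    (∀ β : ℝ, 2.424 < β → refinedRatio β < firstRatio β) := by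
  refine ⟨?_, fun n G y h => h.exists_cover, fun β hβ y hy ε hε => ?_,
    fun β hβ => refinedRatio_lt_firstRatio (by linarith)⟩
  · obtain ⟨p, hp⟩ := loopBounded_vertexCover.exists_polynomial
    exact ⟨vertexCover, p, fun n es => ⟨hp _, isAlgorithmOutput_vertexCover es⟩⟩
  -- No averaging is needed: the bound holds for every matching, hence for the expectation, even
  -- without `ε`.
  · filter_upwards [eventually_ge_atTop 0, Real.tendsto_exp_atTop.eventually_ge_atTop 1000]
      with α hα hexp
    exact modelExpectation_le fun σ =>
      (ratio_le_refinedRatio hβ hα hexp σ (hy α σ)).trans (by linarith)
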